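/- Let $(M,g,J)$ be a compact Hermitian manifold: $(M,g)$ is a compact smooth Riemannian manifold and $J$ is a smooth endomorphism of $T_{\mathbb R}M$ with $J^2=-1$, $g(JX,JY)=g(X,Y)$ and vanishing Nijenhuis tensor $N_J(X,Y)=[X,Y]+J[JX,Y]+J[X,JY]-[JX,JY]$. Let $\nabla^{\mathrm{Ch},\mathbb R}$ be the real Chern connection of $(M,g,J)$, i.e. the real connection on $T_{\mathbb R}M$ with $\nabla g=0$ and $\nabla J=0$ whose $\mathbb C$-linear extension restricts on the holomorphic tangent bundle $T^{1,0}M$ to the Chern connection, the connection compatible with the Hermitian metric induced by $g$ and with the holomorphic structure $\bar\partial$ of $T^{1,0}M$. Let $$\mathrm{Ric}(\nabla^{\mathrm{Ch},\mathbb R},g)(X,Y)=\sum_i g\bigl(R(X,e_i)e_i,Y\bigr),\qquad R(X,Y)Z=\nabla_X\nabla_YZ-\nabla_Y\nabla_XZ-\nabla_{[X,Y]}Z,$$ where $\nabla=\nabla^{\mathrm{Ch},\mathbb R}$ and $\{e_i\}$ is a local $g$-orthonormal frame of $T_{\mathbb R}M$. Suppose that $\nabla^{\mathrm{Ch},\mathbb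 R}$ is real Chern-Einstein with constant $\lambda\in\mathbb R$, i.e. $\mathrm{Ric}(\nabla^{\mathrm{Ch},\mathbb R},g)=\lambda g$. If $\lambda\neq0$, then $(M,g,J)$ is Kähler-Einstein: the fundamental form $\omega(X,Y)=g(JX,Y)$ satisfies $d\omega=0$, and the Ricci curvature of the Levi-Civita connection of $g$ is a constant multiple of $g$. -/

import Mathlib

open Bundle VectorField
open scoped Manifold ContDiff

noncomputable section

namespace HermGeom

variable {E : Type*} [NormedAddCommGroup E] [NormedSpace ℝ E]
  {M : Type*} [TopologicalSpace M] [ChartedSpace E M] [IsManifold 𝓘(ℝ, E) ∞ M]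

/-- A vector field `X` on `M` is smooth near the point `x`. -/
def SmoothAt (X : Π y : M, TangentSpace 𝓘(ℝ, E) y) (x : M) : Prop :=
  ContMDiffAt 𝓘(ℝ, E) (𝓘(ℝ, E).prod 𝓘(ℝ, E)) ∞ (fun y ↦ TotalSpace.mk' E y (X y)) x

/-- A smooth endomorphism field `J` of the real tangent bundle that turns the Riemannian manifold
`(M, g)` (the metric `g` is `inner ℝ` on the tangent spaces) into a Hermitian manifold `(M, g, J)`:
`J² = -1`, `g(Ju, Jv) = g(u, v)`, and the Nijenhuis tensor
`N_J(X, Y) = [X, Y] + J[JX, Y] + J[X, JY] - [JX, JY]` vanishes. -/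
structure HermitianStructure (E M : Type*) [NormedAddCommGroup E] [NormedSpace ℝ E]
    [TopologicalSpace M] [ChartedSpace E M] [IsManifold 𝓘(ℝ, E) ∞ M]
    [RiemannianBundle (fun x : M ↦ TangentSpace 𝓘(ℝ, E) x)] where
  /-- The endomorphism of each tangent space. -/
  J : Π x : M, TangentSpace 𝓘(ℝ, E) x →L[ℝ] TangentSpace 𝓘(ℝ, E) x
  smooth : ContMDiff 𝓘(ℝ, E) (𝓘(ℝ, E).prod 𝓘(ℝ, E →L[ℝ] E)) ∞
    (fun x ↦ TotalSpace.mk' (E →L[ℝ] E)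
      (E := fun x : M ↦ TangentSpace 𝓘(ℝ, E) x →L[ℝ] TangentSpace 𝓘(ℝ, E) x) x (J x))
  sq : ∀ (x : M) (v : TangentSpace 𝓘(ℝ, E) x), J x (J x v) = -v
  compat : ∀ (x : M) (u v : TangentSpace 𝓘(ℝ, E) x), inner ℝ (J x u) (J x v) = inner ℝ u v
  integrable : ∀ (x : M) (X Y : Π y : M, TangentSpace 𝓘(ℝ, E) y), SmoothAt X x → SmoothAt Y x →
    mlieBracket 𝓘(ℝ, E) X Y x
      + J x (mlieBracket 𝓘(ℝ, E) (fun y ↦ J y (X y)) Y x)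
      + J x (mlieBracket 𝓘(ℝ, E) X (fun y ↦ J y (Y y)) x)
      - mlieBracket 𝓘(ℝ, E) (fun y ↦ J y (X y)) (fun y ↦ J y (Y y)) x = 0

/-! ### Complex vector fields -/

/-- A section `re + i im` of the complexified tangent bundle `T_ℂ M = TM ⊗ ℂ`. -/
@[ext] structure ComplexField (E M : Type*) [NormedAddCommGroup E] [NormedSpace ℝ E]
    [TopologicalSpace M] [ChartedSpace E M] where
  /-- The real part. -/
  re : Π x : M, TangentSpace 𝓘(ℝ, E) x
  /-- The imaginary part. -/
  im : Π x : M, TangentSpace 𝓘(ℝ, E) x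

/-- The `ℂ`-bilinear extension of the Lie bracket to complex vector fields. -/
def complexBracket (W Z : ComplexField E M) : ComplexField E M where
  re x := mlieBracket 𝓘(ℝ, E) W.re Z.re x - mlieBracket 𝓘(ℝ, E) W.im Z.im x
  im x := mlieBracket 𝓘(ℝ, E) W.re Z.im x + mlieBracket 𝓘(ℝ, E) W.im Z.re x

/-- The `ℂ`-bilinear extension `∇_W Z` of a real connection to complex vector fields. -/
def complexCov (nabla : CovariantDerivative 𝓘(ℝ, E) E (TangentSpace 𝓘(ℝ, E) : M → Type _))
    (W Z : ComplexField E M) : ComplexField E M where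
  re x := nabla Z.re x (W.re x) - nabla Z.im x (W.im x)
  im x := nabla Z.im x (W.re x) + nabla Z.re x (W.im x)

section J

variable (J : Π x : M, TangentSpace 𝓘(ℝ, E) x →L[ℝ] TangentSpace 𝓘(ℝ, E) x)

/-- The projection `Z ↦ (Z - iJZ) / 2` of `T_ℂ M` onto the holomorphic tangent bundle `T^{1,0} M`,
the `i`-eigenbundle of (the `ℂ`-linear extension of) `J`. -/
def proj10 (Z : ComplexField E M) : ComplexField E M where
  re x := (1 / 2 : ℝ) • (Z.re x + J x (Z.im x))
  im x := (1 / 2 : ℝ) • (Z.im x - J x (Z.re x))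

/-- The section `(Y - iJY) / 2` of `T^{1,0} M`. Every section `Z` of `T^{1,0} M` has this form, with
`Y = 2 Re Z`. -/
def field10 (Y : Π x : M, TangentSpace 𝓘(ℝ, E) x) : ComplexField E M where
  re x := (1 / 2 : ℝ) • Y x
  im x := -((1 / 2 : ℝ) • J x (Y x))

/-- The section `(X + iJX) / 2` of `T^{0,1} M`. Every section `W` of `T^{0,1} M` has this form, with
`X = 2 Re W`. -/
def field01 (X : Π x : M, TangentSpace 𝓘(ℝ, E) x) : ComplexField E M where
  re x := (1 / 2 : ℝ) • X x
  im x := (1 / 2 : ℝ) • J x (X x)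

/-- The Cauchy-Riemann operator `∂̄_W Z = [W, Z]^{1,0}` of the holomorphic vector bundle `T^{1,0} M`,
for `W` a section of `T^{0,1} M` and `Z` a section of `T^{1,0} M`. In local holomorphic coordinates
it sends `W = ∂/∂z̄ⁱ`, `Z = ∑ fʲ ∂/∂zʲ` to `∑ (∂fʲ/∂z̄ⁱ) ∂/∂zʲ`. -/
def dbar (W Z : ComplexField E M) : ComplexField E M := proj10 J (complexBracket W Z)

end J

/-! ### Curvature of real connections -/

section Curvature

variable (nabla : CovariantDerivative 𝓘(ℝ, E) E (TangentSpace 𝓘(ℝ, E) : M → Type _))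

/-- `R(X, Y)Z = ∇_X ∇_Y Z - ∇_Y ∇_X Z - ∇_{[X, Y]} Z` for vector fields. -/
def curvatureField (X Y Z : Π x : M, TangentSpace 𝓘(ℝ, E) x) (x : M) : TangentSpace 𝓘(ℝ, E) x :=
  nabla (fun y ↦ nabla Z y (Y y)) x (X x) - nabla (fun y ↦ nabla Z y (X y)) x (Y x)
    - nabla Z x (mlieBracket 𝓘(ℝ, E) X Y x)

/-- The curvature endomorphism `R(u, v)w` at tangent vectors: the vectors are extended to vector
fields that are smooth near `x` (for a smooth connection the result does not depend on the
extension). -/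
def curvature (x : M) (u v w : TangentSpace 𝓘(ℝ, E) x) : TangentSpace 𝓘(ℝ, E) x :=
  curvatureField nabla (FiberBundle.extend E u) (FiberBundle.extend E v) (FiberBundle.extend E w) x

variable [FiniteDimensional ℝ E] [RiemannianBundle (fun x : M ↦ TangentSpace 𝓘(ℝ, E) x)]

instance (x : M) : FiniteDimensional ℝ (TangentSpace 𝓘(ℝ, E) x) :=
  inferInstanceAs (FiniteDimensional ℝ E)

/-- The Ricci curvature `Ric(∇, g)(u, v) = ∑ᵢ g(R(u, eᵢ)eᵢ, v)`, where `(eᵢ)` is a `g`-orthonormal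
basis of the tangent space (the result does not depend on the basis). -/
def ricci (x : M) (u v : TangentSpace 𝓘(ℝ, E) x) : ℝ :=
  ∑ i, inner ℝ (curvature nabla x u (stdOrthonormalBasis ℝ (TangentSpace 𝓘(ℝ, E) x) i)
    (stdOrthonormalBasis ℝ (TangentSpace 𝓘(ℝ, E) x) i)) v

/-- `Ric(∇, g) = c g`. -/
def IsEinsteinWith (c : ℝ) : Prop :=
  ∀ (x : M) (u v : TangentSpace 𝓘(ℝ, E) x), ricci nabla x u v = c * inner ℝ u v

end Curvature

section Metric

variable [FiniteDimensional ℝ E]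
  [RiemannianBundle (fun x : M ↦ TangentSpace 𝓘(ℝ, E) x)]

/-- `∇g = 0`, that is, `u (g(Y, Z)) = g(∇_u Y, Z) + g(Y, ∇_u Z)`. -/
def IsMetric (nabla : CovariantDerivative 𝓘(ℝ, E) E (TangentSpace 𝓘(ℝ, E) : M → Type _)) : Prop :=
  ∀ (x : M) (Y Z : Π y : M, TangentSpace 𝓘(ℝ, E) y), SmoothAt Y x → SmoothAt Z x →
    ∀ u : TangentSpace 𝓘(ℝ, E) x,
      mvfderiv 𝓘(ℝ, E) (fun y ↦ (inner ℝ (Y y) (Z y) : ℝ)) x u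
        = inner ℝ (nabla Y x u) (Z x) + inner ℝ (Y x) (nabla Z x u)

/-- `nabla` is the Levi-Civita connection of `g`: smooth, metric and torsion-free. -/
structure IsLeviCivita
    (nabla : CovariantDerivative 𝓘(ℝ, E) E (TangentSpace 𝓘(ℝ, E) : M → Type _)) : Prop where
  smooth : CovariantDerivative.ContMDiffCovariantDerivative nabla ∞
  metric : IsMetric nabla
  torsion_free : ∀ (x : M) (X Y : Π y : M, TangentSpace 𝓘(ℝ, E) y), SmoothAt X x → SmoothAt Y x →
    nabla Y x (X x) - nabla X x (Y x) = mlieBracket 𝓘(ℝ, E) X Y x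

variable (S : HermitianStructure E M)

/-- `nabla` is the real Chern connection of `(M, g, J)`: the smooth real connection with `∇g = 0` and
`∇J = 0` whose `ℂ`-linear extension, restricted to `T^{1,0} M`, is the Chern connection, that is,
its `(0,1)`-part is the Cauchy-Riemann operator of the holomorphic bundle `T^{1,0} M`. -/
structure IsRealChern
    (nabla : CovariantDerivative 𝓘(ℝ, E) E (TangentSpace 𝓘(ℝ, E) : M → Type _)) : Prop where
  smooth : CovariantDerivative.ContMDiffCovariantDerivative nabla ∞
  metric : IsMetric nabla
  parallel : ∀ (x : M) (Y : Π y : M, TangentSpace 𝓘(ℝ, E) y), SmoothAt Y x →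
    ∀ u : TangentSpace 𝓘(ℝ, E) x, nabla (fun y ↦ S.J y (Y y)) x u = S.J x (nabla Y x u)
  holomorphic : ∀ (x : M) (X Y : Π y : M, TangentSpace 𝓘(ℝ, E) y), SmoothAt X x → SmoothAt Y x →
    (complexCov nabla (field01 S.J X) (field10 S.J Y)).re x
        = (dbar S.J (field01 S.J X) (field10 S.J Y)).re x ∧
      (complexCov nabla (field01 S.J X) (field10 S.J Y)).im x
        = (dbar S.J (field01 S.J X) (field10 S.J Y)).im x

/-- `(M, g, J, ∇^{Ch,ℝ})` is real Chern-Einstein with constant `c`: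
the real Chern connection satisfies `Ric(∇^{Ch,ℝ}, g) = c g`. -/
def IsRealChernEinstein (c : ℝ) : Prop :=
  ∃ nabla : CovariantDerivative 𝓘(ℝ, E) E (TangentSpace 𝓘(ℝ, E) : M → Type _),
    IsRealChern S nabla ∧ IsEinsteinWith nabla c

/-- The fundamental form `ω(X, Y) = g(JX, Y)` on vector fields. -/
def fundamentalForm (X Y : Π x : M, TangentSpace 𝓘(ℝ, E) x) (x : M) : ℝ :=
  inner ℝ (S.J x (X x)) (Y x)

/-- `(M, g, J)` is Kähler: `dω = 0`, where
`dω(X, Y, Z) = X ω(Y, Z) - Y ω(X, Z) + Z ω(X, Y) - ω([X, Y], Z) + ω([X, Z], Y) - ω([Y, Z], X)`. -/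
def IsKahler : Prop :=
  ∀ (x : M) (X Y Z : Π y : M, TangentSpace 𝓘(ℝ, E) y),
    SmoothAt X x → SmoothAt Y x → SmoothAt Z x →
    mvfderiv 𝓘(ℝ, E) (fundamentalForm S Y Z) x (X x)
      - mvfderiv 𝓘(ℝ, E) (fundamentalForm S X Z) x (Y x)
      + mvfderiv 𝓘(ℝ, E) (fundamentalForm S X Y) x (Z x)
      - fundamentalForm S (mlieBracket 𝓘(ℝ, E) X Y) Z x
      + fundamentalForm S (mlieBracket 𝓘(ℝ, E) X Z) Y x
      - fundamentalForm S (mlieBracket 𝓘(ℝ, E) Y Z) X x = 0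

/-- `(M, g, J)` is Kähler-Einstein: it is Kähler, and the Ricci curvature of the Levi-Civita
connection of `g` is a constant multiple of `g`. -/
def IsKahlerEinstein : Prop :=
  IsKahler S ∧
    ∃ nabla : CovariantDerivative 𝓘(ℝ, E) E (TangentSpace 𝓘(ℝ, E) : M → Type _),
      IsLeviCivita nabla ∧ ∃ c : ℝ, IsEinsteinWith nabla c

end Metric

end HermGeom

end

open Bundle VectorField
open scoped Manifold ContDiff

noncomputable section

set_option maxSynthPendingDepth 6

namespace HermGeom

/-! ### Directional derivatives of operator-valued functions -/

section LineDeriv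

variable {E V W : Type*} [NormedAddCommGroup E] [NormedSpace ℝ E]
  [NormedAddCommGroup V] [NormedSpace ℝ V] [NormedAddCommGroup W] [NormedSpace ℝ W]
  {z w : E}

/-! The Einstein condition exhibits `c ω` as a sum of two `∂̄`-closed forms, where `ω = g(J·, ·)`;
as `c ≠ 0`, `ω` is closed and the torsion vanishes. In detail, the Chern torsion `T` is complex
bilinear and the Chern curvature `R` is of type (1,1) (`R_JJ`). Put `τ(u) = tr T(u, ·)` and `ρ(u, v)
= tr (J R(u, v))`. The trace of the (1,1)-part of the first Bianchi identity reads `2cω = ρ - β`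
with `β(w, u) = (∇_w τ)(Ju) - (∇_{Jw} τ)(u)` (`N_sub_N`). The form `ρ` is closed, being the trace of
a curvature, and `β = 2i ∂̄(τ^{1,0})`, so `∂̄β = 0`. The computation is done with real tensors in a
chart (`LocalChern`). There `bianchi_ρ` plays the role of `dρ = 0`, the Ricci identity
`covN_sub_covN` together with `R_JJ` that of `∂̄² = 0`, and `T_eq_zero` combines them.
`IsRealChern.localChern` carries the result to the manifold: the Chern connection is torsion free,
hence it is the Levi-Civita connection. Then `∇J = 0` gives `dω = 0`, and the assumed Ricci identity
is already the one for the Levi-Civita connection. -/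

theorem hasLineDerivAt_fderiv {f : E → V} (hf : DifferentiableAt ℝ f z) (w : E) :
    HasLineDerivAt ℝ f (fderiv ℝ f z w) z w :=
  hf.hasFDerivAt.hasLineDerivAt w

theorem hasLineDerivAt_const' (c : V) : HasLineDerivAt ℝ (fun _ : E ↦ c) 0 z w :=
  hasDerivAt_const _ _

theorem _root_.HasLineDerivAt.clm_apply {A : E → V →L[ℝ] W} {A' : V →L[ℝ] W} {f : E → V} {f' : V}
    (hA : HasLineDerivAt ℝ A A' z w) (hf : HasLineDerivAt ℝ f f' z w) :
    HasLineDerivAt ℝ (fun y ↦ A y (f y)) (A' (f z) + A z f') z w := by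
  simpa [HasLineDerivAt] using HasDerivAt.clm_apply hA hf

theorem _root_.HasLineDerivAt.clm_apply_const {A : E → V →L[ℝ] W} {A' : V →L[ℝ] W}
    (hA : HasLineDerivAt ℝ A A' z w) (v : V) : HasLineDerivAt ℝ (fun y ↦ A y v) (A' v) z w := by
  simpa using hA.clm_apply (hasLineDerivAt_const' v)

theorem _root_.HasLineDerivAt.clm_map (L : V →L[ℝ] W) {f : E → V} {f' : V}
    (hf : HasLineDerivAt ℝ f f' z w) : HasLineDerivAt ℝ (fun y ↦ L (f y)) (L f') z w := by
  simpa using (hasLineDerivAt_const' L).clm_apply hf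

theorem _root_.HasLineDerivAt.add' {f h : E → V} {f' h' : V} (hf : HasLineDerivAt ℝ f f' z w)
    (hh : HasLineDerivAt ℝ h h' z w) : HasLineDerivAt ℝ (fun y ↦ f y + h y) (f' + h') z w :=
  HasDerivAt.add hf hh

theorem _root_.HasLineDerivAt.sub' {f h : E → V} {f' h' : V} (hf : HasLineDerivAt ℝ f f' z w)
    (hh : HasLineDerivAt ℝ h h' z w) : HasLineDerivAt ℝ (fun y ↦ f y - h y) (f' - h') z w :=
  HasDerivAt.sub hf hh

theorem _root_.HasLineDerivAt.clm_comp {A : E → V →L[ℝ] W} {A' : V →L[ℝ] W} {B : E → E →L[ℝ] V}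
    {B' : E →L[ℝ] V} (hA : HasLineDerivAt ℝ A A' z w) (hB : HasLineDerivAt ℝ B B' z w) :
    HasLineDerivAt ℝ (fun y ↦ (A y).comp (B y)) (A'.comp (B z) + (A z).comp B') z w := by
  simpa [HasLineDerivAt] using HasDerivAt.clm_comp hA hB

/-- The device by which tensor identities valid on an open set are differentiated: each side is
differentiated by the product rule in a fixed direction, and the two results agree by uniqueness. -/
theorem _root_.HasLineDerivAt.eq_of_eqOn {f h : E → V} {f' h' : V} {Ω : Set E} (hΩ : IsOpen Ω)
    (hz : z ∈ Ω) (hf : HasLineDerivAt ℝ f f' z w) (hh : HasLineDerivAt ℝ h h' z w)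
    (hfh : ∀ y ∈ Ω, f y = h y) : f' = h' := by
  have h1 : f =ᶠ[nhds z] h := Filter.eventuallyEq_of_mem (hΩ.mem_nhds hz) hfh
  exact (hf.congr_of_eventuallyEq h1.symm).unique hh

theorem hasLineDerivAt_of_contDiffOn {f : E → V} {Ω : Set E} (hf : ContDiffOn ℝ ∞ f Ω)
    (hΩ : IsOpen Ω) (hz : z ∈ Ω) (w : E) : HasLineDerivAt ℝ f (fderiv ℝ f z w) z w :=
  hasLineDerivAt_fderiv ((hf.differentiableOn (by simp)).differentiableAt (hΩ.mem_nhds hz)) w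

theorem contDiffOn_fderiv {f : E → V} {Ω : Set E} (hf : ContDiffOn ℝ ∞ f Ω) (hΩ : IsOpen Ω) :
    ContDiffOn ℝ ∞ (fderiv ℝ f) Ω :=
  hf.fderiv_of_isOpen hΩ (by simp)

theorem fderiv_fderiv_symm {f : E → V} {Ω : Set E} (hΩ : IsOpen Ω) (hf : ContDiffOn ℝ ∞ f Ω)
    (hz : z ∈ Ω) (u v : E) :
    fderiv ℝ (fderiv ℝ f) z u v = fderiv ℝ (fderiv ℝ f) z v u := by
  have h1 := (hf.contDiffAt (hΩ.mem_nhds hz)).isSymmSndFDerivAt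
    (by rw [minSmoothness_of_isRCLikeNormedField]; exact WithTop.coe_le_coe.2 le_top)
  exact h1 u v

end LineDeriv

/-! ### Traces of continuous endomorphisms -/

section Trace

variable {E : Type*} [NormedAddCommGroup E] [NormedSpace ℝ E] [FiniteDimensional ℝ E]

/-- The trace of endomorphisms of a finite-dimensional space as a continuous linear form. -/
def traceCLM (E : Type*) [NormedAddCommGroup E] [NormedSpace ℝ E] [FiniteDimensional ℝ E] :
    (E →L[ℝ] E) →L[ℝ] ℝ :=
  LinearMap.toContinuousLinearMap
    ((LinearMap.trace ℝ E).comp (ContinuousLinearMap.coeLM ℝ))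

theorem traceCLM_apply (A : E →L[ℝ] E) : traceCLM E A = LinearMap.trace ℝ E A := rfl

theorem traceCLM_comm (A B : E →L[ℝ] E) : traceCLM E (A.comp B) = traceCLM E (B.comp A) := by
  simp only [traceCLM_apply, ContinuousLinearMap.toLinearMap_comp]
  exact LinearMap.trace_mul_comm ℝ (A : E →ₗ[ℝ] E) (B : E →ₗ[ℝ] E)

/-- An endomorphism that is skew for a definite bilinear form has trace zero. -/
theorem traceCLM_eq_zero_of_skew (g : E →L[ℝ] E →L[ℝ] ℝ) (hpos : ∀ v, v ≠ 0 → 0 < g v v)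
    (A : E →L[ℝ] E) (hA : ∀ u v, g (A u) v = -g u (A v)) : traceCLM E A = 0 := by
  let f : E →ₗ[ℝ] Module.Dual ℝ E := (ContinuousLinearMap.coeLM ℝ).comp (g : E →ₗ[ℝ] E →L[ℝ] ℝ)
  have hf : Function.Injective f := by
    rw [injective_iff_map_eq_zero]
    intro v hv
    by_contra hne
    have h1 : g v v = 0 := congrArg (fun l : Module.Dual ℝ E ↦ l v) hv
    exact absurd h1 (hpos v hne).ne'
  let e : E ≃ₗ[ℝ] Module.Dual ℝ E :=
    LinearEquiv.ofInjectiveOfFinrankEq f hf (Subspace.dual_finrank_eq).symm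
  -- Under the identification of `E` with its dual by `g`, skewness turns `A` into minus its
  -- transpose, whence `tr A = -tr A`.
  have h2 : e.conj (A : E →ₗ[ℝ] E) = -Module.Dual.transpose (R := ℝ) (A : E →ₗ[ℝ] E) := by
    ext l v
    obtain ⟨u, rfl⟩ := e.surjective l
    rw [LinearEquiv.conj_apply_apply, LinearEquiv.symm_apply_apply]
    exact hA u v
  have h3 := LinearMap.trace_conj' (R := ℝ) (A : E →ₗ[ℝ] E) e
  have h4 : LinearMap.trace ℝ (Module.Dual ℝ E)
      (-Module.Dual.transpose (R := ℝ) (A : E →ₗ[ℝ] E)) = -LinearMap.trace ℝ E A := by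
    rw [← LinearMap.trace_transpose' (R := ℝ) (A : E →ₗ[ℝ] E)]
    exact map_neg (LinearMap.trace ℝ (Module.Dual ℝ E)) _
  rw [h2, h4] at h3
  rw [traceCLM_apply]
  linarith

end Trace

/-! ### Hermitian connections on open subsets of a vector space -/

/-- A Hermitian structure on an open subset `Ω` of a vector space together with a Hermitian
connection `∇_u Y = DY(u) + Γ(u)Y` whose torsion is complex linear. -/
structure LocalChern (E : Type*) [NormedAddCommGroup E] [NormedSpace ℝ E] (Ω : Set E) where
  /-- The Christoffel symbols. -/
  Γ : E → E →L[ℝ] E →L[ℝ] E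
  /-- The almost complex structure. -/
  J : E → E →L[ℝ] E
  /-- The metric. -/
  g : E → E →L[ℝ] E →L[ℝ] ℝ
  isOpen : IsOpen Ω
  smooth_Γ : ContDiffOn ℝ ∞ Γ Ω
  smooth_J : ContDiffOn ℝ ∞ J Ω
  smooth_g : ContDiffOn ℝ ∞ g Ω
  sq : ∀ z ∈ Ω, ∀ v, J z (J z v) = -v
  symm : ∀ z ∈ Ω, ∀ u v, g z u v = g z v u
  pos : ∀ z ∈ Ω, ∀ v, v ≠ 0 → 0 < g z v v
  compat : ∀ z ∈ Ω, ∀ u v, g z (J z u) (J z v) = g z u v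
  parallel : ∀ z ∈ Ω, ∀ u v, fderiv ℝ J z u v = J z (Γ z u v) - Γ z u (J z v)
  metric : ∀ z ∈ Ω, ∀ w u v, fderiv ℝ g z w u v = g z (Γ z w u) v + g z u (Γ z w v)
  torsion_J' : ∀ z ∈ Ω, ∀ u v, Γ z (J z u) v - Γ z v (J z u) = J z (Γ z u v - Γ z v u)

namespace LocalChern

variable {E : Type*} [NormedAddCommGroup E] [NormedSpace ℝ E]
  {Ω : Set E} (D : LocalChern E Ω) {z : E}

/-- The torsion tensor. -/
def T (z : E) : E →L[ℝ] E →L[ℝ] E := D.Γ z - (D.Γ z).flip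

theorem T_apply (u v : E) : D.T z u v = D.Γ z u v - D.Γ z v u := rfl

theorem T_antisymm (u v : E) : D.T z u v = -D.T z v u := by simp [T_apply]

/-- The curvature tensor. -/
def R (z : E) : E →L[ℝ] E →L[ℝ] E →L[ℝ] E :=
  fderiv ℝ D.Γ z - (fderiv ℝ D.Γ z).flip
    + ((ContinuousLinearMap.compL ℝ E E E).bilinearComp (D.Γ z) (D.Γ z))
    - ((ContinuousLinearMap.compL ℝ E E E).bilinearComp (D.Γ z) (D.Γ z)).flip

theorem R_def (u v : E) : D.R z u v = fderiv ℝ D.Γ z u v - fderiv ℝ D.Γ z v u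
    + (D.Γ z u).comp (D.Γ z v) - (D.Γ z v).comp (D.Γ z u) := rfl

theorem R_apply (u v w : E) : D.R z u v w = fderiv ℝ D.Γ z u v w - fderiv ℝ D.Γ z v u w
    + D.Γ z u (D.Γ z v w) - D.Γ z v (D.Γ z u w) := rfl

theorem R_antisymm (u v : E) : D.R z u v = -D.R z v u := by
  rw [R_def, R_def]; abel

theorem line_Γ (hz : z ∈ Ω) (w : E) : HasLineDerivAt ℝ D.Γ (fderiv ℝ D.Γ z w) z w :=
  hasLineDerivAt_of_contDiffOn D.smooth_Γ D.isOpen hz w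

theorem line_J (hz : z ∈ Ω) (w : E) : HasLineDerivAt ℝ D.J (fderiv ℝ D.J z w) z w :=
  hasLineDerivAt_of_contDiffOn D.smooth_J D.isOpen hz w

theorem line_g (hz : z ∈ Ω) (w : E) : HasLineDerivAt ℝ D.g (fderiv ℝ D.g z w) z w :=
  hasLineDerivAt_of_contDiffOn D.smooth_g D.isOpen hz w

theorem line_fderiv_Γ (hz : z ∈ Ω) (w : E) :
    HasLineDerivAt ℝ (fderiv ℝ D.Γ) (fderiv ℝ (fderiv ℝ D.Γ) z w) z w :=
  hasLineDerivAt_of_contDiffOn (contDiffOn_fderiv D.smooth_Γ D.isOpen) D.isOpen hz w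

/-- Differentiate the coordinate form of `∇J = 0` once more and antisymmetrize: the second
derivatives of `J` drop out and the curvature remains. -/
theorem R_J (hz : z ∈ Ω) (u v x : E) : D.R z u v (D.J z x) = D.J z (D.R z u v x) := by
  have key : ∀ w u, fderiv ℝ (fderiv ℝ D.J) z w u x =
      fderiv ℝ D.J z w (D.Γ z u x) + D.J z (fderiv ℝ D.Γ z w u x)
        - (fderiv ℝ D.Γ z w u (D.J z x) + D.Γ z u (fderiv ℝ D.J z w x)) := fun w u ↦
    HasLineDerivAt.eq_of_eqOn D.isOpen hz
      (((hasLineDerivAt_of_contDiffOn (contDiffOn_fderiv D.smooth_J D.isOpen) D.isOpen hz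
        w).clm_apply_const u).clm_apply_const x)
      (((D.line_J hz w).clm_apply (((D.line_Γ hz w).clm_apply_const u).clm_apply_const x)).sub'
        (((D.line_Γ hz w).clm_apply_const u).clm_apply ((D.line_J hz w).clm_apply_const x)))
      fun y hy ↦ D.parallel y hy u x
  have h1 := key u v
  have h2 := key v u
  rw [fderiv_fderiv_symm D.isOpen D.smooth_J hz u v] at h1
  simp only [D.parallel z hz, map_sub] at h1 h2
  simp only [R_apply, map_add, map_sub]
  linear_combination (norm := module) h1 - h2

/-- The same argument as for `R_J`, applied to `∇g = 0`. -/
theorem R_skew (hz : z ∈ Ω) (u v x y : E) : D.g z (D.R z u v x) y = -D.g z x (D.R z u v y) := by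
  have key : ∀ w u, fderiv ℝ (fderiv ℝ D.g) z w u x y =
      fderiv ℝ D.g z w (D.Γ z u x) y + D.g z (fderiv ℝ D.Γ z w u x) y
        + (fderiv ℝ D.g z w x (D.Γ z u y) + D.g z x (fderiv ℝ D.Γ z w u y)) := fun w u ↦
    HasLineDerivAt.eq_of_eqOn D.isOpen hz
      ((((hasLineDerivAt_of_contDiffOn (contDiffOn_fderiv D.smooth_g D.isOpen) D.isOpen hz
        w).clm_apply_const u).clm_apply_const x).clm_apply_const y)
      ((((D.line_g hz w).clm_apply
        (((D.line_Γ hz w).clm_apply_const u).clm_apply_const x)).clm_apply_const y).add'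
        (((D.line_g hz w).clm_apply_const x).clm_apply
          (((D.line_Γ hz w).clm_apply_const u).clm_apply_const y)))
      fun p hp ↦ D.metric p hp u x y
  have h1 := key u v
  have h2 := key v u
  rw [fderiv_fderiv_symm D.isOpen D.smooth_g hz u v] at h1
  simp only [D.metric z hz] at h1 h2
  simp only [R_apply, map_add, map_sub, add_apply,
    sub_apply]
  linear_combination h2 - h1

theorem torsion_J (hz : z ∈ Ω) (u v : E) : D.T z (D.J z u) v = D.J z (D.T z u v) :=
  D.torsion_J' z hz u v

theorem torsion_J_right (hz : z ∈ Ω) (u v : E) : D.T z u (D.J z v) = D.J z (D.T z u v) := by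
  rw [T_antisymm, D.torsion_J hz, D.T_antisymm u v, map_neg]

/-- The covariant derivative `(∇_w T)(u, ·)` of the torsion. -/
def covT (z w u : E) : E →L[ℝ] E :=
  fderiv ℝ D.T z w u + (D.Γ z w).comp (D.T z u) - D.T z (D.Γ z w u) - (D.T z u).comp (D.Γ z w)

theorem covT_apply (w u v : E) : D.covT z w u v =
    fderiv ℝ D.T z w u v + D.Γ z w (D.T z u v) - D.T z (D.Γ z w u) v - D.T z u (D.Γ z w v) := rfl

section FiniteDimensional

variable [FiniteDimensional ℝ E]

theorem smooth_T : ContDiffOn ℝ ∞ D.T Ω := by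
  refine contDiffOn_clm_apply.2 fun u ↦ contDiffOn_clm_apply.2 fun v ↦ ?_
  exact ((D.smooth_Γ.clm_apply contDiffOn_const).clm_apply contDiffOn_const).sub
    ((D.smooth_Γ.clm_apply contDiffOn_const).clm_apply contDiffOn_const)

theorem smooth_R : ContDiffOn ℝ ∞ D.R Ω := by
  refine contDiffOn_clm_apply.2 fun u ↦ contDiffOn_clm_apply.2 fun v ↦ ?_
  have h := contDiffOn_fderiv D.smooth_Γ D.isOpen
  have h1 := fun u v : E ↦ (h.clm_apply (contDiffOn_const (c := u))).clm_apply
    (contDiffOn_const (c := v))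
  have h2 := fun u : E ↦ D.smooth_Γ.clm_apply (contDiffOn_const (c := u))
  exact (((h1 u v).sub (h1 v u)).add ((h2 u).clm_comp (h2 v))).sub ((h2 v).clm_comp (h2 u))

theorem line_T (hz : z ∈ Ω) (w : E) : HasLineDerivAt ℝ D.T (fderiv ℝ D.T z w) z w :=
  hasLineDerivAt_of_contDiffOn D.smooth_T D.isOpen hz w

theorem line_R (hz : z ∈ Ω) (w : E) : HasLineDerivAt ℝ D.R (fderiv ℝ D.R z w) z w :=
  hasLineDerivAt_of_contDiffOn D.smooth_R D.isOpen hz w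

theorem fderiv_T (hz : z ∈ Ω) (w u v : E) :
    fderiv ℝ D.T z w u v = fderiv ℝ D.Γ z w u v - fderiv ℝ D.Γ z w v u :=
  HasLineDerivAt.eq_of_eqOn D.isOpen hz
    (((D.line_T hz w).clm_apply_const u).clm_apply_const v)
    ((((D.line_Γ hz w).clm_apply_const u).clm_apply_const v).sub'
      (((D.line_Γ hz w).clm_apply_const v).clm_apply_const u)) fun _ _ ↦ rfl

theorem covT_antisymm (hz : z ∈ Ω) (w u v : E) : D.covT z w u v = -D.covT z w v u := by
  simp only [covT_apply, D.fderiv_T hz, T_apply, map_sub]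
  abel

/-- Since `∇J = 0`, the covariant derivative of the identity `T(Ju, v) = J T(u, v)` has no term from
`J`. -/
theorem covT_J (hz : z ∈ Ω) (w u v : E) :
    D.covT z w (D.J z u) v = D.J z (D.covT z w u v) := by
  have key := HasLineDerivAt.eq_of_eqOn D.isOpen hz
    (((D.line_T hz w).clm_apply ((D.line_J hz w).clm_apply_const u)).clm_apply_const v)
    ((D.line_J hz w).clm_apply (((D.line_T hz w).clm_apply_const u).clm_apply_const v))
    fun y hy ↦ D.torsion_J hy u v
  simp only [D.parallel z hz, map_sub, add_apply,
    sub_apply, D.torsion_J hz] at key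
  simp only [covT_apply, map_sub, map_add, D.torsion_J hz]
  linear_combination (norm := module) key

theorem covT_J_right (hz : z ∈ Ω) (w u v : E) :
    D.covT z w u (D.J z v) = D.J z (D.covT z w u v) := by
  rw [D.covT_antisymm hz, D.covT_J hz, D.covT_antisymm hz w u v, map_neg]

/-- The first Bianchi identity. -/
theorem bianchi_first (hz : z ∈ Ω) (u v w : E) :
    D.R z u v w + D.R z v w u + D.R z w u v =
      D.covT z u v w + D.covT z v w u + D.covT z w u v
        + (D.T z (D.T z u v) w + D.T z (D.T z v w) u + D.T z (D.T z w u) v) := by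
  simp only [covT_apply, R_apply, D.fderiv_T hz, T_apply, map_sub, sub_apply]
  abel

/-- This says that the curvature of `T^{1,0}` has no (0,2)-part. The combination of four Bianchi
identities is chosen so that every torsion term, being complex linear in the relevant slots,
cancels. -/
theorem R_antilinear (hz : z ∈ Ω) (u v w : E) :
    D.R z u v w - D.R z (D.J z u) (D.J z v) w
      = -D.J z (D.R z (D.J z u) v w + D.R z u (D.J z v) w) := by
  have h1 := D.bianchi_first hz u v w
  have h2 := D.bianchi_first hz (D.J z u) (D.J z v) w
  have h3 := congrArg (D.J z) (D.bianchi_first hz (D.J z u) v w)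
  have h4 := congrArg (D.J z) (D.bianchi_first hz u (D.J z v) w)
  simp only [D.covT_J hz, D.covT_J_right hz, D.torsion_J hz, D.torsion_J_right hz, D.R_J hz,
    map_add, D.sq z hz, map_neg, neg_apply] at h1 h2 h3 h4
  rw [map_add]
  linear_combination (norm := module) h1 - h2 + h3 + h4

/-- The curvature is of type `(1,1)`. -/
theorem R_JJ (hz : z ∈ Ω) (u v : E) : D.R z (D.J z u) (D.J z v) = D.R z u v := by
  have hJ : ∀ x y, D.g z (D.J z x) y = -D.g z x (D.J z y) := fun x y ↦ by
    have := D.compat z hz x (D.J z y)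
    rw [D.sq z hz, map_neg] at this
    linarith
  ext w
  by_contra hne
  -- The endomorphism `A = R(u, v) - R(Ju, Jv)` is `g`-skew. By `R_antilinear` it also equals `-J`
  -- times a skew endomorphism commuting with `J`, which is `g`-symmetric (`h2`). Hence `g(Aw, Aw) =
  -- 0`.
  have h1 : ∀ x, D.g z (D.R z u v w - D.R z (D.J z u) (D.J z v) w) x
      = -D.g z w (D.R z u v x - D.R z (D.J z u) (D.J z v) x) := fun x ↦ by
    simp only [map_sub, sub_apply, D.R_skew hz]
    ring
  have h2 : ∀ x, D.g z (-D.J z (D.R z (D.J z u) v w + D.R z u (D.J z v) w)) x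
      = -D.g z w (D.J z (D.R z (D.J z u) v x + D.R z u (D.J z v) x)) := fun x ↦ by
    simp only [map_add, map_neg, add_apply, neg_apply, hJ, D.R_skew hz, D.R_J hz]
    ring
  rw [← D.R_antilinear hz] at h2
  have h3 := D.pos z hz _ (sub_ne_zero.2 (Ne.symm hne))
  generalize D.R z u v w - D.R z (D.J z u) (D.J z v) w = a at h1 h2 h3
  have h4 := h1 a
  rw [D.R_antilinear hz, map_neg] at h4
  linarith [h2 a]

theorem R_J_swap (hz : z ∈ Ω) (u v : E) : D.R z u (D.J z v) = -D.R z (D.J z u) v := by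
  rw [← D.R_JJ hz u (D.J z v), D.sq z hz, map_neg]

/-- The `(1,1)`-part of the first Bianchi identity. -/
theorem bianchi_first_mixed (hz : z ∈ Ω) (u v w : E) :
    D.R z v w u - D.J z (D.R z (D.J z v) w u) + D.R z w u v - D.J z (D.R z w (D.J z u) v)
      = D.covT z w u v + D.J z (D.covT z (D.J z w) u v) := by
  -- Adding to the identity at `w` the `J`-image of the identity at `Jw` cancels all terms complex
  -- linear in `w`: the quadratic torsion terms, `∇_u T`, `∇_v T` and `R(u, v)w`.
  have h1 := D.bianchi_first hz u v w
  have h2 := congrArg (D.J z) (D.bianchi_first hz u v (D.J z w))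
  simp only [D.covT_J hz, D.covT_J_right hz, D.torsion_J hz, D.torsion_J_right hz, D.R_J hz,
    map_add, D.sq z hz, map_neg, D.R_J_swap hz, neg_apply] at h1 h2 ⊢
  linear_combination (norm := module) h1 + h2

end FiniteDimensional

end LocalChern

namespace LocalChern

variable {E : Type*} [NormedAddCommGroup E] [NormedSpace ℝ E] [FiniteDimensional ℝ E]
  {Ω : Set E} (D : LocalChern E Ω) {z : E}

/-! ### Torsion form and Chern-Ricci form -/

/-- The trace `τ(u) = tr T(u, ·)` of the torsion. -/
def τ (z : E) : E →L[ℝ] ℝ := (traceCLM E).comp (D.T z)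

theorem τ_apply (u : E) : D.τ z u = traceCLM E (D.T z u) := rfl

/-- The covariant derivative `(∇_w τ)(u)` of the torsion form. -/
def N (z : E) : E →L[ℝ] E →L[ℝ] ℝ :=
  fderiv ℝ D.τ z - (ContinuousLinearMap.compL ℝ E E ℝ (D.τ z)).comp (D.Γ z)

theorem N_apply (w u : E) : D.N z w u = fderiv ℝ D.τ z w u - D.τ z (D.Γ z w u) := rfl

/-- The Chern-Ricci form `ρ(u, v) = tr (J R(u, v))`. -/
def ρ (z : E) : E →L[ℝ] E →L[ℝ] ℝ :=
  (ContinuousLinearMap.compL ℝ E (E →L[ℝ] E) ℝ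
    ((traceCLM E).comp (ContinuousLinearMap.compL ℝ E E E (D.J z)))).comp (D.R z)

theorem ρ_apply (u v : E) : D.ρ z u v = traceCLM E ((D.J z).comp (D.R z u v)) := rfl

theorem ρ_antisymm (u v : E) : D.ρ z u v = -D.ρ z v u := by
  rw [ρ_apply, ρ_apply, D.R_antisymm, ContinuousLinearMap.comp_neg, map_neg]

theorem ρ_JJ (hz : z ∈ Ω) (u v : E) : D.ρ z (D.J z u) (D.J z v) = D.ρ z u v := by
  rw [ρ_apply, ρ_apply, D.R_JJ hz]

theorem smooth_τ : ContDiffOn ℝ ∞ D.τ Ω :=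
  contDiffOn_const.clm_comp D.smooth_T

theorem smooth_N : ContDiffOn ℝ ∞ D.N Ω := by
  refine contDiffOn_clm_apply.2 fun u ↦ contDiffOn_clm_apply.2 fun v ↦ ?_
  exact (((contDiffOn_fderiv D.smooth_τ D.isOpen).clm_apply contDiffOn_const).clm_apply
    contDiffOn_const).sub (D.smooth_τ.clm_apply ((D.smooth_Γ.clm_apply contDiffOn_const).clm_apply
      contDiffOn_const))

theorem smooth_ρ : ContDiffOn ℝ ∞ D.ρ Ω := by
  refine contDiffOn_clm_apply.2 fun u ↦ contDiffOn_clm_apply.2 fun v ↦ ?_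
  exact (traceCLM E).contDiff.comp_contDiffOn (D.smooth_J.clm_comp
    ((D.smooth_R.clm_apply contDiffOn_const).clm_apply contDiffOn_const))

theorem line_τ (hz : z ∈ Ω) (w : E) : HasLineDerivAt ℝ D.τ (fderiv ℝ D.τ z w) z w :=
  hasLineDerivAt_of_contDiffOn D.smooth_τ D.isOpen hz w

theorem line_N (hz : z ∈ Ω) (w : E) : HasLineDerivAt ℝ D.N (fderiv ℝ D.N z w) z w :=
  hasLineDerivAt_of_contDiffOn D.smooth_N D.isOpen hz w

theorem line_ρ (hz : z ∈ Ω) (w : E) : HasLineDerivAt ℝ D.ρ (fderiv ℝ D.ρ z w) z w :=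
  hasLineDerivAt_of_contDiffOn D.smooth_ρ D.isOpen hz w

theorem fderiv_τ (hz : z ∈ Ω) (w u : E) :
    fderiv ℝ D.τ z w u = traceCLM E (fderiv ℝ D.T z w u) :=
  HasLineDerivAt.eq_of_eqOn D.isOpen hz ((D.line_τ hz w).clm_apply_const u)
    (((D.line_T hz w).clm_apply_const u).clm_map (traceCLM E)) fun _ _ ↦ rfl

/-- The trace is parallel: the two compositions of `Γ(w)` with `T(u, ·)` form a commutator, of trace
zero. -/
theorem trace_covT (hz : z ∈ Ω) (w u : E) : traceCLM E (D.covT z w u) = D.N z w u := by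
  rw [N_apply, D.fderiv_τ hz, covT, τ_apply]
  simp only [map_sub, map_add, traceCLM_comm (D.Γ z w)]
  ring

/-- The covariant derivative of `∇τ`. -/
def covN (z w u v : E) : ℝ :=
  fderiv ℝ D.N z w u v - D.N z (D.Γ z w u) v - D.N z u (D.Γ z w v)

/-- `covN` is a bare function, so the sign produced by `J² = -1` in its middle slot needs its own
rule. -/
theorem covN_neg (w u v : E) : D.covN z w (-u) v = -D.covN z w u v := by
  simp only [covN, map_neg, neg_apply]
  ring

/-- The covariant derivative of the Chern-Ricci form. -/
def covρ (z w u v : E) : ℝ :=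
  fderiv ℝ D.ρ z w u v - D.ρ z (D.Γ z w u) v - D.ρ z u (D.Γ z w v)

/-- The Ricci identity for the torsion form. -/
theorem covN_sub_covN (hz : z ∈ Ω) (w u v : E) :
    D.covN z w u v - D.covN z u w v = -D.τ z (D.R z w u v) - D.N z (D.T z w u) v := by
  have key : ∀ w u, fderiv ℝ D.N z w u v = fderiv ℝ (fderiv ℝ D.τ) z w u v
      - (fderiv ℝ D.τ z w (D.Γ z u v) + D.τ z (fderiv ℝ D.Γ z w u v)) := fun w u ↦
    HasLineDerivAt.eq_of_eqOn D.isOpen hz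
      (((D.line_N hz w).clm_apply_const u).clm_apply_const v)
      ((((hasLineDerivAt_of_contDiffOn (contDiffOn_fderiv D.smooth_τ D.isOpen) D.isOpen hz
        w).clm_apply_const u).clm_apply_const v).sub' ((D.line_τ hz w).clm_apply
          (((D.line_Γ hz w).clm_apply_const u).clm_apply_const v))) fun _ _ ↦ rfl
  simp only [covN, key, fderiv_fderiv_symm D.isOpen D.smooth_τ hz w u, N_apply, R_apply, T_apply,
    map_add, map_sub, sub_apply]
  ring

/-- The second Bianchi identity for the Chern-Ricci form. -/
theorem bianchi_ρ (hz : z ∈ Ω) (u v w : E) :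
    D.covρ z u v w + D.covρ z v w u + D.covρ z w u v
      + (D.ρ z (D.T z u v) w + D.ρ z (D.T z v w) u + D.ρ z (D.T z w u) v) = 0 := by
  have dR : ∀ w u v, fderiv ℝ D.R z w u v =
      fderiv ℝ (fderiv ℝ D.Γ) z w u v - fderiv ℝ (fderiv ℝ D.Γ) z w v u
        + ((fderiv ℝ D.Γ z w u).comp (D.Γ z v) + (D.Γ z u).comp (fderiv ℝ D.Γ z w v))
        - ((fderiv ℝ D.Γ z w v).comp (D.Γ z u) + (D.Γ z v).comp (fderiv ℝ D.Γ z w u)) :=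
    fun w u v ↦ HasLineDerivAt.eq_of_eqOn D.isOpen hz
      (((D.line_R hz w).clm_apply_const u).clm_apply_const v)
      ((((((D.line_fderiv_Γ hz w).clm_apply_const u).clm_apply_const v).sub'
        (((D.line_fderiv_Γ hz w).clm_apply_const v).clm_apply_const u)).add'
        (((D.line_Γ hz w).clm_apply_const u).clm_comp ((D.line_Γ hz w).clm_apply_const v))).sub'
        (((D.line_Γ hz w).clm_apply_const v).clm_comp ((D.line_Γ hz w).clm_apply_const u)))
      fun _ _ ↦ rfl
  have dJ : ∀ w, fderiv ℝ D.J z w = (D.J z).comp (D.Γ z w) - (D.Γ z w).comp (D.J z) := fun w ↦ by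
    ext v
    exact D.parallel z hz w v
  -- As `∇J = 0` and the trace is parallel, the derivative falls on `R` alone.
  have dρ : ∀ w u v, fderiv ℝ D.ρ z w u v = traceCLM E ((D.J z).comp
      (fderiv ℝ D.R z w u v + (D.Γ z w).comp (D.R z u v) - (D.R z u v).comp (D.Γ z w))) :=
    fun w u v ↦ by
      have h1 := HasLineDerivAt.eq_of_eqOn D.isOpen hz
        (((D.line_ρ hz w).clm_apply_const u).clm_apply_const v)
        (((D.line_J hz w).clm_comp
          (((D.line_R hz w).clm_apply_const u).clm_apply_const v)).clm_map (traceCLM E))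
        fun _ _ ↦ rfl
      have h2 := traceCLM_comm (D.Γ z w) ((D.J z).comp (D.R z u v))
      rw [h1, dJ]
      simp only [ContinuousLinearMap.comp_sub, ContinuousLinearMap.comp_add,
        ContinuousLinearMap.sub_comp, map_add, map_sub, ContinuousLinearMap.comp_assoc] at h2 ⊢
      linarith
  -- The second Bianchi identity for `R` as an endomorphism-valued 2-form: only the endomorphism
  -- slot is corrected by `Γ`. The corrections in the form slots, contained in `covρ`, produce the
  -- torsion terms of the statement.
  have cyc : ∀ a b c, (fderiv ℝ D.R z a b c + (D.Γ z a).comp (D.R z b c) - (D.R z b c).comp (D.Γ z a))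
      + (fderiv ℝ D.R z b c a + (D.Γ z b).comp (D.R z c a) - (D.R z c a).comp (D.Γ z b))
      + (fderiv ℝ D.R z c a b + (D.Γ z c).comp (D.R z a b) - (D.R z a b).comp (D.Γ z c)) = 0 := by
    intro a b c
    simp only [dR, R_def, fderiv_fderiv_symm D.isOpen D.smooth_Γ hz b a,
      fderiv_fderiv_symm D.isOpen D.smooth_Γ hz c a, fderiv_fderiv_symm D.isOpen D.smooth_Γ hz c b]
    ext x
    simp only [ContinuousLinearMap.comp_apply, add_apply, sub_apply, map_add, map_sub, zero_apply]
    abel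
  have h1 : fderiv ℝ D.ρ z u v w + fderiv ℝ D.ρ z v w u + fderiv ℝ D.ρ z w u v = 0 := by
    rw [dρ, dρ, dρ, ← map_add, ← map_add, ← ContinuousLinearMap.comp_add,
      ← ContinuousLinearMap.comp_add, cyc, ContinuousLinearMap.comp_zero, map_zero]
  simp only [covρ, T_apply, map_sub, sub_apply]
  linarith [D.ρ_antisymm (z := z) v (D.Γ z u w), D.ρ_antisymm (z := z) w (D.Γ z v u),
    D.ρ_antisymm (z := z) u (D.Γ z w v)]

theorem covρ_antisymm (hz : z ∈ Ω) (w u v : E) : D.covρ z w u v = -D.covρ z w v u := by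
  have h1 := HasLineDerivAt.eq_of_eqOn D.isOpen hz
    (((D.line_ρ hz w).clm_apply_const u).clm_apply_const v)
    ((hasLineDerivAt_const' (0 : ℝ)).sub' (((D.line_ρ hz w).clm_apply_const v).clm_apply_const u))
    fun y _ ↦ by rw [zero_sub]; exact D.ρ_antisymm u v
  rw [covρ, covρ, h1, D.ρ_antisymm u (D.Γ z w v), D.ρ_antisymm (D.Γ z w u) v]
  ring

/-- The covariant derivative of `ρ_JJ`; the derivatives of `J` are absorbed because `∇J = 0`. -/
theorem covρ_JJ (hz : z ∈ Ω) (w u v : E) :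
    D.covρ z w (D.J z u) (D.J z v) = D.covρ z w u v := by
  have h1 := HasLineDerivAt.eq_of_eqOn D.isOpen hz
    (((D.line_ρ hz w).clm_apply ((D.line_J hz w).clm_apply_const u)).clm_apply
      ((D.line_J hz w).clm_apply_const v))
    (((D.line_ρ hz w).clm_apply_const u).clm_apply_const v) fun y hy ↦ D.ρ_JJ hy u v
  have h2 := D.ρ_JJ hz (D.Γ z w u) v
  have h3 := D.ρ_JJ hz u (D.Γ z w v)
  simp only [D.parallel z hz, add_apply, sub_apply, map_sub] at h1
  simp only [covρ]
  linarith

/-- The trace of the `(1,1)`-part of the first Bianchi identity for a Chern-Einstein metric. -/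
theorem N_sub_N {c : ℝ}
    (hE : ∀ z ∈ Ω, ∀ u v, traceCLM E ((D.R z u).flip v) = -(c * D.g z u v))
    (hz : z ∈ Ω) (w u : E) :
    D.N z w (D.J z u) - D.N z (D.J z w) u = 2 * c * D.g z w (D.J z u) - D.ρ z u w := by
  have key : ∀ u, D.N z w u + D.N z (D.J z w) (D.J z u)
      = 2 * c * D.g z w u + D.ρ z (D.J z u) w := fun u ↦ by
    -- `bianchi_first_mixed` read as an identity of endomorphisms of its first argument. In its
    -- trace, `tr R(u, w)` vanishes by skewness and the Einstein condition enters twice, the second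
    -- time through `h3`; hence the factor `2 * c`.
    have h1 : D.R z u w - (D.J z).comp (D.R z (D.J z u) w) + (D.R z w).flip u
        - (D.J z).comp (((D.R z w).flip u).comp (D.J z))
          = -D.covT z w u - D.covT z (D.J z w) (D.J z u) := by
      ext x
      have h2 := D.bianchi_first_mixed hz x u w
      rw [D.covT_antisymm hz w x u, D.covT_antisymm hz _ x u, map_neg, ← D.covT_J hz] at h2
      simpa [sub_eq_add_neg] using h2
    have h3 : traceCLM E ((D.J z).comp (((D.R z w).flip u).comp (D.J z)))
        = -traceCLM E ((D.R z w).flip u) := by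
      rw [traceCLM_comm, ContinuousLinearMap.comp_assoc, ← map_neg]
      congr 1
      ext x
      simp [D.sq z hz]
    have h4 : traceCLM E (D.R z u w) = 0 :=
      traceCLM_eq_zero_of_skew (D.g z) (D.pos z hz) _ (D.R_skew hz u w)
    have h5 := congrArg (traceCLM E) h1
    simp only [map_sub, map_add, map_neg, h3, h4, D.trace_covT hz, hE z hz] at h5
    rw [ρ_apply]
    linarith
  have h := key (D.J z u)
  simp only [D.sq z hz, map_neg, neg_apply] at h
  linarith

/-- A Chern-Einstein metric with nonzero constant has no torsion. -/
theorem T_eq_zero {c : ℝ} (hc : c ≠ 0)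
    (hE : ∀ z ∈ Ω, ∀ u v, traceCLM E ((D.R z u).flip v) = -(c * D.g z u v))
    (hz : z ∈ Ω) (u v : E) : D.T z u v = 0 := by
  -- The covariant derivative of `N_sub_N`: since `g` and `J` are parallel the metric term
  -- disappears.
  have cov : ∀ w u v, D.covN z w u (D.J z v) - D.covN z w (D.J z u) v = -D.covρ z w v u :=
    fun w u v ↦ by
      have h1 := HasLineDerivAt.eq_of_eqOn D.isOpen hz
        ((((D.line_N hz w).clm_apply_const u).clm_apply ((D.line_J hz w).clm_apply_const v)).sub'
          (((D.line_N hz w).clm_apply ((D.line_J hz w).clm_apply_const u)).clm_apply_const v))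
        (((((D.line_g hz w).clm_apply_const u).clm_apply
          ((D.line_J hz w).clm_apply_const v)).clm_map
            (ContinuousLinearMap.lsmul ℝ ℝ (2 * c) : ℝ →L[ℝ] ℝ)).sub'
          (((D.line_ρ hz w).clm_apply_const v).clm_apply_const u))
        fun y hy ↦ D.N_sub_N hE hy u v
      have h2 := D.N_sub_N hE hz (D.Γ z w u) v
      have h3 := D.N_sub_N hE hz u (D.Γ z w v)
      simp only [D.parallel z hz, D.metric z hz, map_add, map_sub, add_apply, sub_apply,
        ContinuousLinearMap.lsmul_apply, smul_eq_mul] at h1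
      simp only [covN, covρ]
      linarith
  have key : ∀ y, 2 * c * D.g z (D.T z u v) (D.J z y) = 0 := fun y ↦ by
    have e1 := cov u v y
    have e2 := cov v u y
    have e3 := cov (D.J z u) (D.J z v) y
    have e4 := cov (D.J z v) (D.J z u) y
    have r1 := D.covN_sub_covN hz u v (D.J z y)
    have r2 := D.covN_sub_covN hz (D.J z u) (D.J z v) (D.J z y)
    -- By `R_JJ` the curvature cancels in `r1 - r2` and in `r3 + r4`. The difference of these two
    -- combinations has right side `-2 (N(T(u, v), Jy) - N(J T(u, v), y))`, to which `m` applies.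
    have r3 := D.covN_sub_covN hz u (D.J z v) y
    have r4 := D.covN_sub_covN hz (D.J z u) v y
    -- In `b1 - b2` the derivative along `y` cancels by `a3`, and of the torsion terms only `2
    -- ρ(T(v, u), y)` survives. It cancels the `ρ`-term of `m`, and only the metric term is left.
    have b1 := D.bianchi_ρ hz u y v
    have b2 := D.bianchi_ρ hz (D.J z u) y (D.J z v)
    have a1 := D.covρ_antisymm hz v u y
    have a2 := D.covρ_antisymm hz (D.J z v) (D.J z u) y
    have a3 := D.covρ_JJ hz y v u
    have m := D.N_sub_N hE hz (D.T z u v) y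
    have s := D.ρ_antisymm (z := z) y (D.T z u v)
    simp only [D.R_JJ hz, D.R_J_swap hz, D.torsion_J hz, D.torsion_J_right hz, D.sq z hz,
      D.ρ_JJ hz, neg_apply, map_neg, D.T_antisymm v u, D.covN_neg] at e3 e4 r2 r3 r4 b1 b2 a3
    linarith
  by_contra hne
  -- This choice of `y` makes `Jy = T(u, v)`.
  have h1 := key (-D.J z (D.T z u v))
  rw [map_neg, D.sq z hz, neg_neg] at h1
  have h2 := D.pos z hz _ hne
  simp [hc, h2.ne'] at h1

end LocalChern

open Filter Topology

/-! ### Vector fields in a chart -/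

section Chart

variable {E : Type*} [NormedAddCommGroup E] [NormedSpace ℝ E]
  {M : Type*} [TopologicalSpace M] [ChartedSpace E M] [IsManifold 𝓘(ℝ, E) ∞ M]
  {F : Type*} [NormedAddCommGroup F] [NormedSpace ℝ F]

/-- The components of a tangent vector in the chart centered at `x₀`. -/
def chartCoord (x₀ y : M) : TangentSpace 𝓘(ℝ, E) y →L[ℝ] E :=
  (trivializationAt E (TangentSpace 𝓘(ℝ, E)) x₀).continuousLinearMapAt ℝ y

/-- The tangent vector with given components in the chart centered at `x₀`. -/
def chartFrame (x₀ y : M) : E →L[ℝ] TangentSpace 𝓘(ℝ, E) y :=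
  (trivializationAt E (TangentSpace 𝓘(ℝ, E)) x₀).symmL ℝ y

variable {x₀ y : M}

theorem chartCoord_chartFrame (hy : y ∈ (chartAt E x₀).source) (v : E) :
    chartCoord x₀ y (chartFrame x₀ y v) = v :=
  (trivializationAt E (TangentSpace 𝓘(ℝ, E)) x₀).continuousLinearMapAt_symmL hy v

theorem chartFrame_chartCoord (hy : y ∈ (chartAt E x₀).source) (v : TangentSpace 𝓘(ℝ, E) y) :
    chartFrame x₀ y (chartCoord x₀ y v) = v :=
  (trivializationAt E (TangentSpace 𝓘(ℝ, E)) x₀).symmL_continuousLinearMapAt hy v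

theorem chartCoord_eq_mfderiv (hy : y ∈ (chartAt E x₀).source) :
    chartCoord x₀ y = mfderiv 𝓘(ℝ, E) 𝓘(ℝ, E) (extChartAt 𝓘(ℝ, E) x₀) y :=
  TangentBundle.continuousLinearMapAt_trivializationAt hy

omit [NormedSpace ℝ E] [IsManifold 𝓘(ℝ, E) ∞ M] in
theorem eventually_mem_chart_source (hy : y ∈ (chartAt E x₀).source) :
    ∀ᶠ p in 𝓝 y, p ∈ (chartAt E x₀).source :=
  (chartAt E x₀).open_source.mem_nhds hy

variable {X Y : Π y : M, TangentSpace 𝓘(ℝ, E) y}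

theorem eventuallyEq_trivialization (hy : y ∈ (chartAt E x₀).source) :
    (fun p ↦ (trivializationAt E (TangentSpace 𝓘(ℝ, E)) x₀ ⟨p, X p⟩).2) =ᶠ[𝓝 y]
      fun p ↦ chartCoord x₀ p (X p) := by
  filter_upwards [eventually_mem_chart_source hy] with p hp
  exact ((trivializationAt E (TangentSpace 𝓘(ℝ, E)) x₀).continuousLinearMapAt_apply_of_mem
    (R := ℝ) hp (X p)).symm

theorem smoothAt_iff_chartCoord (hy : y ∈ (chartAt E x₀).source) :
    SmoothAt X y ↔ ContMDiffAt 𝓘(ℝ, E) 𝓘(ℝ, E) ∞ (fun p ↦ chartCoord x₀ p (X p)) y := by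
  refine ((trivializationAt E (TangentSpace 𝓘(ℝ, E)) x₀).contMDiffAt_section_iff hy).trans ?_
  exact (eventuallyEq_trivialization hy).contMDiffAt_iff

theorem mdifferentiableAt_iff_chartCoord (hy : y ∈ (chartAt E x₀).source) :
    MDifferentiableAt 𝓘(ℝ, E) (𝓘(ℝ, E).prod 𝓘(ℝ, E)) (fun p ↦ TotalSpace.mk' E p (X p)) y ↔
      MDifferentiableAt 𝓘(ℝ, E) 𝓘(ℝ, E) (fun p ↦ chartCoord x₀ p (X p)) y := by
  refine ((trivializationAt E (TangentSpace 𝓘(ℝ, E)) x₀).mdifferentiableAt_section_iff _ _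
    hy).trans ?_
  exact (eventuallyEq_trivialization hy).mdifferentiableAt_iff

theorem SmoothAt.mdifferentiableAt (hX : SmoothAt X y) :
    MDifferentiableAt 𝓘(ℝ, E) (𝓘(ℝ, E).prod 𝓘(ℝ, E)) (fun p ↦ TotalSpace.mk' E p (X p)) y :=
  ContMDiffAt.mdifferentiableAt hX (by simp)

/-- A function on `M` read in the chart centered at `x₀`. -/
def chartFun (x₀ : M) (f : M → F) (z : E) : F := f ((extChartAt 𝓘(ℝ, E) x₀).symm z)

omit [IsManifold 𝓘(ℝ, E) ∞ M] [NormedAddCommGroup F] [NormedSpace ℝ F] in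
theorem chartFun_apply_chart {f : M → F} (hy : y ∈ (chartAt E x₀).source) :
    chartFun x₀ f (extChartAt 𝓘(ℝ, E) x₀ y) = f y := by
  rw [chartFun, (extChartAt 𝓘(ℝ, E) x₀).left_inv (by rwa [extChartAt_source])]

theorem contMDiffAt_chart_symm (hy : y ∈ (chartAt E x₀).source) :
    ContMDiffAt 𝓘(ℝ, E) 𝓘(ℝ, E) ∞ (extChartAt 𝓘(ℝ, E) x₀).symm (extChartAt 𝓘(ℝ, E) x₀ y) :=
  (contMDiffOn_extChartAt_symm x₀).contMDiffAt ((isOpen_extChartAt_target x₀).mem_nhds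
    ((extChartAt 𝓘(ℝ, E) x₀).map_source (by rwa [extChartAt_source])))

theorem contMDiffAt_chart (hy : y ∈ (chartAt E x₀).source) :
    ContMDiffAt 𝓘(ℝ, E) 𝓘(ℝ, E) ∞ (extChartAt 𝓘(ℝ, E) x₀) y :=
  (contMDiffOn_extChartAt (x := x₀)).contMDiffAt ((chartAt E x₀).open_source.mem_nhds hy)

theorem contDiffAt_chartFun {f : M → F} (hy : y ∈ (chartAt E x₀).source)
    (hf : ContMDiffAt 𝓘(ℝ, E) 𝓘(ℝ, F) ∞ f y) :
    ContDiffAt ℝ ∞ (chartFun x₀ f) (extChartAt 𝓘(ℝ, E) x₀ y) := by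
  rw [← contMDiffAt_iff_contDiffAt]
  exact ContMDiffAt.comp_of_eq hf (contMDiffAt_chart_symm hy)
    ((extChartAt 𝓘(ℝ, E) x₀).left_inv (by rwa [extChartAt_source]))

theorem mvfderiv_eq_fderiv_chartFun {f : M → F} (hy : y ∈ (chartAt E x₀).source)
    (hf : MDifferentiableAt 𝓘(ℝ, E) 𝓘(ℝ, F) f y) (v : TangentSpace 𝓘(ℝ, E) y) :
    mvfderiv 𝓘(ℝ, E) f y v
      = fderiv ℝ (chartFun x₀ f) (extChartAt 𝓘(ℝ, E) x₀ y) (chartCoord x₀ y v) := by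
  have h1 : f =ᶠ[𝓝 y] chartFun x₀ f ∘ extChartAt 𝓘(ℝ, E) x₀ := by
    filter_upwards [eventually_mem_chart_source hy] with p hp
    exact (chartFun_apply_chart hp).symm
  have h2 : MDifferentiableAt 𝓘(ℝ, E) 𝓘(ℝ, F) (chartFun x₀ f) (extChartAt 𝓘(ℝ, E) x₀ y) :=
    MDifferentiableAt.comp_of_eq _ hf ((contMDiffAt_chart_symm hy).mdifferentiableAt (by simp))
      ((extChartAt 𝓘(ℝ, E) x₀).left_inv (by rwa [extChartAt_source]))
  have h3 : mfderiv 𝓘(ℝ, E) 𝓘(ℝ, F) f y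
      = (mfderiv 𝓘(ℝ, E) 𝓘(ℝ, F) (chartFun x₀ f) (extChartAt 𝓘(ℝ, E) x₀ y)).comp
        (mfderiv 𝓘(ℝ, E) 𝓘(ℝ, E) (extChartAt 𝓘(ℝ, E) x₀) y) := by
    rw [← mfderiv_comp y h2 ((contMDiffAt_chart hy).mdifferentiableAt (by simp))]
    exact h1.mfderiv_eq
  rw [mfderiv_eq_fderiv] at h3
  rw [chartCoord_eq_mfderiv hy]
  exact congrArg (fun L ↦ L v) h3

theorem smoothAt_chartFrame (hy : y ∈ (chartAt E x₀).source) (v : E) :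
    SmoothAt (fun p ↦ chartFrame x₀ p v) y := by
  rw [smoothAt_iff_chartCoord hy]
  refine (contMDiffAt_const (c := v)).congr_of_eventuallyEq ?_
  filter_upwards [eventually_mem_chart_source hy] with p hp
  exact chartCoord_chartFrame hp v

/-- A constant vector field on a vector space. -/
def constField (v : E) (z : E) : TangentSpace 𝓘(ℝ, E) z := v

theorem mdifferentiableAt_constField (v z : E) : MDifferentiableAt 𝓘(ℝ, E)
    (𝓘(ℝ, E).prod 𝓘(ℝ, E)) (fun p ↦ TotalSpace.mk' E p (constField v p)) z := by
  rw [mdifferentiableAt_section]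
  refine (mdifferentiableAt_const (c := v)).congr_of_eventuallyEq (Eventually.of_forall fun p ↦ ?_)
  exact congrArg Prod.snd
    (trivializationAt_model_space_apply (I := 𝓘(ℝ, E)) (TotalSpace.mk' E p (constField v p)) z)

/-- Coordinate fields are pullbacks of constant fields by the chart, and pullback respects the
bracket. -/
theorem mlieBracket_chartFrame [CompleteSpace E] (hy : y ∈ (chartAt E x₀).source) (u v : E) :
    mlieBracket 𝓘(ℝ, E) (fun p ↦ chartFrame x₀ p u) (fun p ↦ chartFrame x₀ p v) y = 0 := by
  have h1 : ∀ v : E, (fun p ↦ chartFrame x₀ p v) =ᶠ[𝓝 y]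
      mpullback 𝓘(ℝ, E) 𝓘(ℝ, E) (extChartAt 𝓘(ℝ, E) x₀) (constField v) := fun v ↦ by
    filter_upwards [eventually_mem_chart_source hy] with p hp
    have h2 : (mfderiv 𝓘(ℝ, E) 𝓘(ℝ, E) (extChartAt 𝓘(ℝ, E) x₀) p) (chartFrame x₀ p v)
        = constField v _ := by
      rw [← chartCoord_eq_mfderiv hp]
      exact chartCoord_chartFrame hp v
    rw [mpullback_apply, ← h2]
    exact ((isInvertible_mfderiv_extChartAt
      (by rwa [extChartAt_source])).inverse_apply_self _).symm
  have h3 : minSmoothness ℝ 2 ≤ ∞ := by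
    rw [minSmoothness_of_isRCLikeNormedField]
    exact WithTop.coe_le_coe.2 le_top
  have : IsManifold 𝓘(ℝ, E) (minSmoothness ℝ 2) M := .of_le (n := ∞) h3
  have : IsManifold 𝓘(ℝ, E) (minSmoothness ℝ 2) E := .of_le (n := ∞) h3
  have h4 : mlieBracket 𝓘(ℝ, E) (constField u) (constField v) (extChartAt 𝓘(ℝ, E) x₀ y) = 0 := by
    have h5 : lieBracket ℝ (fun _ : E ↦ u) (fun _ : E ↦ v) (extChartAt 𝓘(ℝ, E) x₀ y) = 0 := by
      simp [lieBracket]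
    rw [← lieBracketWithin_univ] at h5
    rw [← mlieBracketWithin_univ, mlieBracketWithin_eq_lieBracketWithin]
    exact h5
  rw [(h1 u).mlieBracket_vectorField_eq (h1 v),
    ← mpullback_mlieBracket (n := ∞) (mdifferentiableAt_constField u _)
      (mdifferentiableAt_constField v _) (contMDiffAt_chart hy) h3, mpullback_apply, h4, map_zero]

/-- The coordinate frame, cut off to a global smooth vector field. -/
def bumpFrame [FiniteDimensional ℝ E] (χ : SmoothBumpFunction 𝓘(ℝ, E) x₀) (v : E) (p : M) :
    TangentSpace 𝓘(ℝ, E) p := χ p • chartFrame x₀ p v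

theorem contMDiff_bumpFrame [FiniteDimensional ℝ E] [T2Space M]
    (χ : SmoothBumpFunction 𝓘(ℝ, E) x₀) (v : E) :
    ContMDiff 𝓘(ℝ, E) (𝓘(ℝ, E).prod 𝓘(ℝ, E)) ∞ (fun p ↦ TotalSpace.mk' E p (bumpFrame χ v p)) := by
  intro y
  by_cases hy : y ∈ (chartAt E x₀).source
  · exact ContMDiffAt.smul_section χ.contMDiffAt (smoothAt_chartFrame hy v)
  · have h1 : ∀ᶠ p in 𝓝 y, χ p = 0 := by
      have : y ∉ tsupport χ := fun h ↦ hy (χ.tsupport_subset_chartAt_source h)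
      exact notMem_tsupport_iff_eventuallyEq.1 this
    refine (contMDiff_zeroSection ℝ (TangentSpace 𝓘(ℝ, E)) y).congr_of_eventuallyEq ?_
    filter_upwards [h1] with p hp
    simp [bumpFrame, hp, zeroSection]

end Chart

/-! ### Connections in a chart -/

section Connection

variable {E : Type*} [NormedAddCommGroup E] [NormedSpace ℝ E] [FiniteDimensional ℝ E]
  {M : Type*} [TopologicalSpace M] [T2Space M] [ChartedSpace E M] [IsManifold 𝓘(ℝ, E) ∞ M]
  (nabla : CovariantDerivative 𝓘(ℝ, E) E (TangentSpace 𝓘(ℝ, E) : M → Type _))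
  {x₀ y : M} (χ : SmoothBumpFunction 𝓘(ℝ, E) x₀)
  {X Y Z : Π y : M, TangentSpace 𝓘(ℝ, E) y}

/-- The open set on which the cut-off coordinate frame agrees with the coordinate frame. -/
def frameSet : Set M := (chartAt E x₀).source ∩ interior {p | χ p = 1}

omit [T2Space M] [IsManifold 𝓘(ℝ, E) ∞ M] in
theorem isOpen_frameSet : IsOpen (frameSet χ) :=
  (chartAt E x₀).open_source.inter isOpen_interior

omit [T2Space M] [IsManifold 𝓘(ℝ, E) ∞ M] in
theorem center_mem_frameSet : x₀ ∈ frameSet χ :=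
  ⟨mem_chart_source E x₀, mem_interior_iff_mem_nhds.2 χ.eventuallyEq_one⟩

variable {χ}

omit [T2Space M] in
theorem bumpFrame_apply (hy : y ∈ frameSet χ) (v : E) : bumpFrame χ v y = chartFrame x₀ y v := by
  have h : y ∈ {p | χ p = 1} := interior_subset hy.2
  have h : χ y = 1 := h
  rw [bumpFrame, h, one_smul]

omit [T2Space M] in
theorem eventuallyEq_bumpFrame (hy : y ∈ frameSet χ) (v : E) :
    bumpFrame χ v =ᶠ[𝓝 y] fun p ↦ chartFrame x₀ p v := by
  filter_upwards [(isOpen_frameSet χ).mem_nhds hy] with p hp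
  exact bumpFrame_apply hp v

omit [T2Space M] in
theorem chartCoord_bumpFrame (hy : y ∈ frameSet χ) (v : E) :
    chartCoord x₀ y (bumpFrame χ v y) = v := by
  rw [bumpFrame_apply hy, chartCoord_chartFrame hy.1]

theorem smoothAt_bumpFrame (v : E) : SmoothAt (bumpFrame χ v) y := contMDiff_bumpFrame χ v y

omit [T2Space M] in
theorem mlieBracket_bumpFrame (hy : y ∈ frameSet χ) (u v : E) :
    mlieBracket 𝓘(ℝ, E) (bumpFrame χ u) (bumpFrame χ v) y = 0 := by
  have := FiniteDimensional.complete ℝ E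
  rw [(eventuallyEq_bumpFrame hy u).mlieBracket_vectorField_eq (eventuallyEq_bumpFrame hy v),
    mlieBracket_chartFrame hy.1]

omit [FiniteDimensional ℝ E] [T2Space M] in
theorem nabla_sum {ι : Type*} (s : Finset ι) {σ : ι → Π y : M, TangentSpace 𝓘(ℝ, E) y}
    (hσ : ∀ i, MDifferentiableAt 𝓘(ℝ, E) (𝓘(ℝ, E).prod 𝓘(ℝ, E))
      (fun p ↦ TotalSpace.mk' E p (σ i p)) y) :
    nabla (fun p ↦ ∑ i ∈ s, σ i p) y = ∑ i ∈ s, nabla (σ i) y := by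
  classical
  induction s using Finset.induction_on with
  | empty =>
    simp only [Finset.sum_empty]
    exact congrFun nabla.zero y
  | insert a s ha h =>
    simp only [Finset.sum_insert ha]
    rw [← h]
    exact nabla.isCovariantDerivativeOnUniv.add (hσ a) (.sum_section fun i _ ↦ hσ i)

variable (χ) in
/-- The Christoffel symbols of a connection in the chart centered at `x₀`. -/
def christoffel (y : M) : E →L[ℝ] E →L[ℝ] E :=
  (∑ i, (LinearMap.toContinuousLinearMap ((Module.finBasis ℝ E).coord i)).smulRight
    ((chartCoord x₀ y).comp
      ((nabla (bumpFrame χ (Module.finBasis ℝ E i)) y).comp (chartFrame x₀ y)))).flip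

omit [T2Space M] in
theorem christoffel_apply (u v : E) : christoffel nabla χ y u v =
    ∑ i, (Module.finBasis ℝ E).repr v i •
      chartCoord x₀ y (nabla (bumpFrame χ (Module.finBasis ℝ E i)) y (chartFrame x₀ y u)) := by
  simp [christoffel]

/-- A connection in coordinates: `∇_w X = DX(w) + Γ(w)X`. -/
theorem chartCoord_nabla (hy : y ∈ frameSet χ)
    (hX : MDifferentiableAt 𝓘(ℝ, E) (𝓘(ℝ, E).prod 𝓘(ℝ, E)) (fun p ↦ TotalSpace.mk' E p (X p)) y)
    (w : TangentSpace 𝓘(ℝ, E) y) :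
    chartCoord x₀ y (nabla X y w) = mvfderiv 𝓘(ℝ, E) (fun p ↦ chartCoord x₀ p (X p)) y w
      + christoffel nabla χ y (chartCoord x₀ y w) (chartCoord x₀ y (X y)) := by
  set b := Module.finBasis ℝ E with hb
  have hc := (mdifferentiableAt_iff_chartCoord hy.1).1 hX
  let l : Fin (Module.finrank ℝ E) → E →L[ℝ] ℝ := fun i ↦ LinearMap.toContinuousLinearMap (b.coord i)
  let f : Fin (Module.finrank ℝ E) → M → ℝ := fun i p ↦ l i (chartCoord x₀ p (X p))
  have hf : ∀ i, MDifferentiableAt 𝓘(ℝ, E) 𝓘(ℝ, ℝ) (f i) y := fun i ↦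
    (l i).differentiableAt.mdifferentiableAt.comp y hc
  have hdf : ∀ i, mvfderiv 𝓘(ℝ, E) (f i) y w
      = l i (mvfderiv 𝓘(ℝ, E) (fun p ↦ chartCoord x₀ p (X p)) y w) := fun i ↦ by
    have h1 := mvfderiv_comp_apply y (g := l i) (f := fun p ↦ chartCoord x₀ p (X p))
      (l i).differentiableAt.mdifferentiableAt hc w
    refine h1.trans ?_
    rw [mvfderiv, mfderiv_eq_fderiv, (l i).fderiv]
    rfl
  have hV : ∀ i, MDifferentiableAt 𝓘(ℝ, E) (𝓘(ℝ, E).prod 𝓘(ℝ, E))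
      (fun p ↦ TotalSpace.mk' E p (bumpFrame χ (b i) p)) y := fun i ↦
    (smoothAt_bumpFrame (b i)).mdifferentiableAt
  have hfV : ∀ i, MDifferentiableAt 𝓘(ℝ, E) (𝓘(ℝ, E).prod 𝓘(ℝ, E))
      (fun p ↦ TotalSpace.mk' E p ((f i • bumpFrame χ (b i)) p)) y := fun i ↦
    (hf i).smul_section (hV i)
  -- Near `y` the field is expanded in the coordinate frame; additivity and the Leibniz rule then
  -- give the formula.
  have hXsum : X =ᶠ[𝓝 y] fun p ↦ ∑ i, (f i • bumpFrame χ (b i)) p := by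
    filter_upwards [(isOpen_frameSet χ).mem_nhds hy] with p hp
    have h1 := congrArg (chartFrame x₀ p) (b.sum_repr (chartCoord x₀ p (X p)))
    rw [chartFrame_chartCoord hp.1, map_sum] at h1
    rw [← h1]
    refine Finset.sum_congr rfl fun i _ ↦ ?_
    rw [map_smul, Pi.smul_apply', bumpFrame_apply hp]
    rfl
  have h1 : nabla X y = ∑ i, nabla (f i • bumpFrame χ (b i)) y := by
    rw [← nabla_sum nabla _ hfV]
    exact nabla.isCovariantDerivativeOnUniv.congr_of_eventuallyEq hX
      (MDifferentiableAt.sum_section fun i _ ↦ hfV i) univ_mem hXsum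
  have h2 : ∀ i, nabla (f i • bumpFrame χ (b i)) y w = f i y • nabla (bumpFrame χ (b i)) y w
      + mvfderiv 𝓘(ℝ, E) (f i) y w • bumpFrame χ (b i) y := fun i ↦ by
    rw [nabla.isCovariantDerivativeOnUniv.leibniz (hV i) (hf i)]
    rfl
  rw [h1, sum_apply, map_sum, christoffel_apply, chartFrame_chartCoord hy.1]
  simp only [h2, map_add, map_smul, Finset.sum_add_distrib, chartCoord_bumpFrame hy, hdf]
  rw [add_comm]
  congr 1
  exact b.sum_repr _

/-- The coordinate formula for a field with constant components; it removes the auxiliary basis used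
in defining `christoffel`. -/
theorem christoffel_eq_nabla (hy : y ∈ frameSet χ) (u v : E) :
    christoffel nabla χ y u v
      = chartCoord x₀ y (nabla (bumpFrame χ v) y (chartFrame x₀ y u)) := by
  have h1 : (fun p ↦ chartCoord x₀ p (bumpFrame χ v p)) =ᶠ[𝓝 y] fun _ ↦ v := by
    filter_upwards [(isOpen_frameSet χ).mem_nhds hy] with p hp
    exact chartCoord_bumpFrame hp v
  have h2 : mvfderiv 𝓘(ℝ, E) (fun p ↦ chartCoord x₀ p (bumpFrame χ v p)) y = 0 := by
    ext w
    have h3 := h1.mfderiv_eq (I := 𝓘(ℝ, E)) (I' := 𝓘(ℝ, E))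
    rw [mfderiv_const] at h3
    exact congrArg (fun L ↦ L w) h3
  rw [chartCoord_nabla nabla hy (smoothAt_bumpFrame v).mdifferentiableAt, h2,
    chartCoord_chartFrame hy.1, chartCoord_bumpFrame hy]
  simp

-- Smoothness of the connection is applied to a field `X` smooth on all of `M`; this is why the
-- coordinate frame is cut off by a bump function.
omit [FiniteDimensional ℝ E] [T2Space M] in
theorem smoothAt_nabla (hn : CovariantDerivative.ContMDiffCovariantDerivative nabla ∞)
    (hX : ContMDiff 𝓘(ℝ, E) (𝓘(ℝ, E).prod 𝓘(ℝ, E)) ∞ (fun p ↦ TotalSpace.mk' E p (X p)))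
    (hY : SmoothAt Y y) : SmoothAt (fun p ↦ nabla X p (Y p)) y := by
  have h1 := hn.contMDiff.contMDiff (σ := X) (by simpa using hX.contMDiffOn)
  exact ((h1 y trivial).contMDiffAt univ_mem).clm_bundle_apply hY

/-- Torsion is tensorial, so it may be evaluated on coordinate fields, whose bracket vanishes. -/
theorem torsion_bumpFrame (hy : y ∈ frameSet χ) (u v : E) :
    haveI := FiniteDimensional.complete ℝ E
    chartCoord x₀ y (nabla.torsion y (chartFrame x₀ y u) (chartFrame x₀ y v))
      = christoffel nabla χ y u v - christoffel nabla χ y v u := by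
  have := FiniteDimensional.complete ℝ E
  rw [christoffel_eq_nabla nabla hy, christoffel_eq_nabla nabla hy, ← bumpFrame_apply hy,
    ← bumpFrame_apply hy, nabla.torsion_apply (smoothAt_bumpFrame u).mdifferentiableAt
      (smoothAt_bumpFrame v).mdifferentiableAt, mlieBracket_bumpFrame hy, sub_zero, map_sub]

/-- The Lie bracket in coordinates. -/
theorem chartCoord_mlieBracket
    (nabla : CovariantDerivative 𝓘(ℝ, E) E (TangentSpace 𝓘(ℝ, E) : M → Type _))
    (hy : y ∈ frameSet χ) (hX : SmoothAt X y) (hY : SmoothAt Y y) :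
    chartCoord x₀ y (mlieBracket 𝓘(ℝ, E) X Y y)
      = mvfderiv 𝓘(ℝ, E) (fun p ↦ chartCoord x₀ p (Y p)) y (X y)
        - mvfderiv 𝓘(ℝ, E) (fun p ↦ chartCoord x₀ p (X p)) y (Y y) := by
  have := FiniteDimensional.complete ℝ E
  -- The torsion of an auxiliary connection is known both by definition and in coordinates.
  -- Comparing the two, the Christoffel symbols cancel and the bracket is determined.
  have h1 := congrArg (chartCoord x₀ y)
    (nabla.torsion_apply hX.mdifferentiableAt hY.mdifferentiableAt)
  have h2 := torsion_bumpFrame nabla hy (chartCoord x₀ y (X y)) (chartCoord x₀ y (Y y))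
  rw [chartFrame_chartCoord hy.1, chartFrame_chartCoord hy.1] at h2
  rw [h2, map_sub, map_sub, chartCoord_nabla nabla hy hX.mdifferentiableAt,
    chartCoord_nabla nabla hy hY.mdifferentiableAt] at h1
  linear_combination (norm := module) h1

end Connection

theorem fderiv_apply_const {E V W : Type*} [NormedAddCommGroup E] [NormedSpace ℝ E]
    [NormedAddCommGroup V] [NormedSpace ℝ V] [NormedAddCommGroup W] [NormedSpace ℝ W]
    {A : E → V →L[ℝ] W} {Ω : Set E}
    (hA : ContDiffOn ℝ ∞ A Ω) (hΩ : IsOpen Ω) {z : E} (hz : z ∈ Ω) (u : E) (v : V) :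
    fderiv ℝ A z u v = fderiv ℝ (fun p ↦ A p v) z u := by
  rw [fderiv_clm_apply ((hA.contDiffAt (hΩ.mem_nhds hz)).differentiableAt (by simp))
    (differentiableAt_const v)]
  simp

/-! ### Hermitian structures and the real Chern connection in a chart -/

section Hermitian

variable {E : Type*} [NormedAddCommGroup E] [NormedSpace ℝ E] [FiniteDimensional ℝ E]
  {M : Type*} [TopologicalSpace M] [ChartedSpace E M] [IsManifold 𝓘(ℝ, E) ∞ M]
  [RiemannianBundle (fun x : M ↦ TangentSpace 𝓘(ℝ, E) x)]
  (S : HermitianStructure E M)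
  {nabla : CovariantDerivative 𝓘(ℝ, E) E (TangentSpace 𝓘(ℝ, E) : M → Type _)}
  {x₀ y : M} {X Y Z : Π y : M, TangentSpace 𝓘(ℝ, E) y}

omit [FiniteDimensional ℝ E] [RiemannianBundle fun x : M ↦ TangentSpace 𝓘(ℝ, E) x] in
theorem smoothAt_extend (x : M) (u : TangentSpace 𝓘(ℝ, E) x) :
    SmoothAt (FiberBundle.extend E u) x :=
  FiberBundle.contMDiffAt_extend 𝓘(ℝ, E) E u

omit [FiniteDimensional ℝ E] in
theorem HermitianStructure.smoothAt_J (hX : SmoothAt X y) :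
    SmoothAt (fun p ↦ S.J p (X p)) y :=
  ContMDiffAt.clm_bundle_apply (S.smooth y) hX

omit [FiniteDimensional ℝ E] [RiemannianBundle fun x : M ↦ TangentSpace 𝓘(ℝ, E) x] in
theorem nabla_const_smul (c : ℝ) (hX : SmoothAt X y) (u : TangentSpace 𝓘(ℝ, E) y) :
    nabla (fun p ↦ c • X p) y u = c • nabla X y u := by
  have h := nabla.isCovariantDerivativeOnUniv.smul_const c hX.mdifferentiableAt (x := y)
  exact congrArg (fun L ↦ L u) h

omit [RiemannianBundle fun x : M ↦ TangentSpace 𝓘(ℝ, E) x] in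
theorem mlieBracket_const_smul (a b : ℝ) (hX : SmoothAt X y) (hY : SmoothAt Y y) :
    mlieBracket 𝓘(ℝ, E) (fun p ↦ a • X p) (fun p ↦ b • Y p) y
      = (a * b) • mlieBracket 𝓘(ℝ, E) X Y y := by
  have := FiniteDimensional.complete ℝ E
  have h1 := mlieBracket_const_smul_left (c := a) (W := fun p ↦ b • Y p) hX.mdifferentiableAt
  have h2 := mlieBracket_const_smul_right (c := b) (V := X) hY.mdifferentiableAt
  refine h1.trans ?_
  rw [mul_smul]
  exact congrArg (a • ·) h2

/-- The torsion of the real Chern connection is complex linear. -/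
theorem IsRealChern.torsion_J (h : IsRealChern S nabla) (x : M) (u v : TangentSpace 𝓘(ℝ, E) x) :
    haveI := FiniteDimensional.complete ℝ E
    nabla.torsion x (S.J x u) v = S.J x (nabla.torsion x u v) := by
  have := FiniteDimensional.complete ℝ E
  set X := FiberBundle.extend E u with hXdef
  set Y := FiberBundle.extend E v with hYdef
  have hX : SmoothAt X x := smoothAt_extend x u
  have hY : SmoothAt Y x := smoothAt_extend x v
  have hXu : X x = u := FiberBundle.extend_apply_self _ _
  have hYv : Y x = v := FiberBundle.extend_apply_self _ _
  have hJX := S.smoothAt_J hX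
  have hJY := S.smoothAt_J hY
  have t1 := nabla.torsion_apply hX.mdifferentiableAt hY.mdifferentiableAt
  have t2 := nabla.torsion_apply hJX.mdifferentiableAt hY.mdifferentiableAt
  rw [hXu, hYv] at t1 t2
  rw [h.parallel x X hX] at t2
  have hint := S.integrable x X Y hX hY
  have hhol := (h.holomorphic x X Y hX hY).1
  have hneg : ∀ u, nabla (fun p ↦ -((1 / 2 : ℝ) • S.J p (Y p))) x u
      = -((1 / 2 : ℝ) • S.J x (nabla Y x u)) := fun u ↦ by
    have := nabla_const_smul (nabla := nabla) (-(1 / 2)) hJY u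
    simp only [neg_smul] at this
    rw [this, h.parallel x Y hY]
  have hb : ∀ W, SmoothAt W x → mlieBracket 𝓘(ℝ, E) (fun p ↦ (1 / 2 : ℝ) • W p)
      (fun p ↦ -((1 / 2 : ℝ) • S.J p (Y p))) x
      = -((1 / 4 : ℝ) • mlieBracket 𝓘(ℝ, E) W (fun p ↦ S.J p (Y p)) x) := fun W hW ↦ by
    have := mlieBracket_const_smul (1 / 2) (-(1 / 2)) hW hJY
    simp only [neg_smul] at this
    rw [this, ← neg_smul]
    norm_num
  have hb' : ∀ W, SmoothAt W x → mlieBracket 𝓘(ℝ, E) (fun p ↦ (1 / 2 : ℝ) • W p)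
      (fun p ↦ (1 / 2 : ℝ) • Y p) x
      = (1 / 4 : ℝ) • mlieBracket 𝓘(ℝ, E) W Y x := fun W hW ↦ by
    rw [mlieBracket_const_smul (1 / 2) (1 / 2) hW hY]
    norm_num
  simp only [complexCov, field01, field10, dbar, proj10, complexBracket, hneg, hb X hX, hb _ hJX,
    hb' X hX, hb' _ hJX, nabla_const_smul _ hY, hXu] at hhol
  have hhol' := congrArg (S.J x) hhol
  have hint' := congrArg (S.J x) hint
  simp only [map_add, map_sub, map_neg, map_smul, S.sq, map_zero] at hhol' hint'
  rw [t1, t2, map_sub, map_sub]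
  -- The factor 4 undoes the two halves in `field01` and `field10`; the remaining half, from
  -- `proj10`, is the coefficient of the Nijenhuis identity.
  linear_combination (norm := module) (-4 : ℝ) • hhol' + (1 / 2 : ℝ) • hint'

section LocalChern

variable [T2Space M] (χ : SmoothBumpFunction 𝓘(ℝ, E) x₀)

/-- The image of the frame set in the chart. -/
def frameTarget : Set E :=
  (extChartAt 𝓘(ℝ, E) x₀).target ∩ (extChartAt 𝓘(ℝ, E) x₀).symm ⁻¹' frameSet χ

omit [IsManifold 𝓘(ℝ, E) ∞ M] [T2Space M]
  [RiemannianBundle fun x : M ↦ TangentSpace 𝓘(ℝ, E) x] in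
theorem isOpen_frameTarget : IsOpen (frameTarget χ) :=
  (continuousOn_extChartAt_symm x₀).isOpen_inter_preimage (isOpen_extChartAt_target x₀)
    (isOpen_frameSet χ)

variable {χ}

omit [IsManifold 𝓘(ℝ, E) ∞ M] [T2Space M]
  [RiemannianBundle fun x : M ↦ TangentSpace 𝓘(ℝ, E) x] in
theorem chart_mem_frameTarget (hy : y ∈ frameSet χ) :
    extChartAt 𝓘(ℝ, E) x₀ y ∈ frameTarget χ := by
  have h1 : y ∈ (extChartAt 𝓘(ℝ, E) x₀).source := by
    rw [extChartAt_source]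
    exact hy.1
  refine ⟨(extChartAt 𝓘(ℝ, E) x₀).map_source h1, ?_⟩
  rw [Set.mem_preimage, (extChartAt 𝓘(ℝ, E) x₀).left_inv h1]
  exact hy

omit [IsManifold 𝓘(ℝ, E) ∞ M] [T2Space M]
  [RiemannianBundle fun x : M ↦ TangentSpace 𝓘(ℝ, E) x] in
theorem frameTarget_cases {p : E → Prop}
    (h : ∀ y ∈ frameSet χ, p (extChartAt 𝓘(ℝ, E) x₀ y)) : ∀ z ∈ frameTarget χ, p z :=
  fun z hz ↦ by
    have := h _ hz.2
    rwa [(extChartAt 𝓘(ℝ, E) x₀).right_inv hz.1] at this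

omit [T2Space M] [RiemannianBundle fun x : M ↦ TangentSpace 𝓘(ℝ, E) x] in
theorem contDiffOn_chartFun {F : Type*} [NormedAddCommGroup F] [NormedSpace ℝ F] {f : M → F}
    (hf : ∀ y ∈ frameSet χ, ContMDiffAt 𝓘(ℝ, E) 𝓘(ℝ, F) ∞ f y) :
    ContDiffOn ℝ ∞ (chartFun x₀ f) (frameTarget χ) :=
  fun z hz ↦ (frameTarget_cases (χ := χ) (p := fun z ↦ ContDiffAt ℝ ∞ (chartFun x₀ f) z)
    (fun y hy ↦ contDiffAt_chartFun hy.1 (hf y hy)) z hz).contDiffWithinAt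

/-- The almost complex structure in a chart. -/
def chartJ (x₀ y : M) : E →L[ℝ] E := (chartCoord x₀ y).comp ((S.J y).comp (chartFrame x₀ y))

/-- The metric in a chart. -/
def chartMetric (x₀ y : M) : E →L[ℝ] E →L[ℝ] ℝ :=
  (innerSL ℝ : TangentSpace 𝓘(ℝ, E) y →L[ℝ] TangentSpace 𝓘(ℝ, E) y →L[ℝ] ℝ).bilinearComp
    (chartFrame x₀ y) (chartFrame x₀ y)

omit [RiemannianBundle fun x : M ↦ TangentSpace 𝓘(ℝ, E) x] in
theorem contMDiffAt_christoffel (h : CovariantDerivative.ContMDiffCovariantDerivative nabla ∞)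
    (hy : y ∈ frameSet χ) (u v : E) :
    ContMDiffAt 𝓘(ℝ, E) 𝓘(ℝ, E) ∞ (fun p ↦ christoffel nabla χ p u v) y := by
  refine ((smoothAt_iff_chartCoord hy.1).1 (smoothAt_nabla nabla h (contMDiff_bumpFrame χ v)
    (smoothAt_bumpFrame (χ := χ) (y := y) u))).congr_of_eventuallyEq ?_
  filter_upwards [(isOpen_frameSet χ).mem_nhds hy] with p hp
  rw [christoffel_eq_nabla nabla hp, bumpFrame_apply hp]

omit [T2Space M] in
theorem contMDiffAt_chartJ (hy : y ∈ frameSet χ) (v : E) :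
    ContMDiffAt 𝓘(ℝ, E) 𝓘(ℝ, E) ∞ (fun p ↦ chartJ S x₀ p v) y := by
  exact (smoothAt_iff_chartCoord hy.1).1 (S.smoothAt_J (smoothAt_chartFrame hy.1 v))

omit [T2Space M] in
theorem contMDiffAt_chartMetric
    [IsContMDiffRiemannianBundle 𝓘(ℝ, E) ∞ E (fun x : M ↦ TangentSpace 𝓘(ℝ, E) x)]
    (hy : y ∈ frameSet χ) (u v : E) :
    ContMDiffAt 𝓘(ℝ, E) 𝓘(ℝ, ℝ) ∞ (fun p ↦ chartMetric x₀ p u v) y :=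
  ContMDiffAt.inner_bundle (E := fun x : M ↦ TangentSpace 𝓘(ℝ, E) x)
    (smoothAt_chartFrame hy.1 u) (smoothAt_chartFrame hy.1 v)

omit [T2Space M] in
theorem contDiffOn_chartJ : ContDiffOn ℝ ∞ (chartFun x₀ (chartJ S x₀)) (frameTarget χ) :=
  contDiffOn_clm_apply.2 fun v ↦ contDiffOn_chartFun fun _ hy ↦ contMDiffAt_chartJ S hy v

omit [T2Space M] in
theorem contDiffOn_chartMetric
    [IsContMDiffRiemannianBundle 𝓘(ℝ, E) ∞ E (fun x : M ↦ TangentSpace 𝓘(ℝ, E) x)] :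
    ContDiffOn ℝ ∞ (chartFun x₀ (chartMetric (E := E) (M := M) x₀)) (frameTarget χ) :=
  contDiffOn_clm_apply.2 fun u ↦ contDiffOn_clm_apply.2 fun v ↦
    contDiffOn_chartFun fun _ hy ↦ contMDiffAt_chartMetric hy u v

omit [RiemannianBundle fun x : M ↦ TangentSpace 𝓘(ℝ, E) x] in
theorem contDiffOn_christoffel (h : CovariantDerivative.ContMDiffCovariantDerivative nabla ∞) :
    ContDiffOn ℝ ∞ (chartFun x₀ (christoffel nabla χ)) (frameTarget χ) :=
  contDiffOn_clm_apply.2 fun u ↦ contDiffOn_clm_apply.2 fun v ↦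
    contDiffOn_chartFun fun _ hy ↦ contMDiffAt_christoffel h hy u v

/-- The condition `∇(JY) = J∇Y` is read for the field `Y` with constant components `v`. -/
theorem IsRealChern.fderiv_chartJ (h : IsRealChern S nabla) (hy : y ∈ frameSet χ) (u v : E) :
    fderiv ℝ (chartFun x₀ (chartJ S x₀)) (extChartAt 𝓘(ℝ, E) x₀ y) u v
      = chartJ S x₀ y (christoffel nabla χ y u v)
        - christoffel nabla χ y u (chartJ S x₀ y v) := by
  have hV : SmoothAt (bumpFrame χ v) y := smoothAt_bumpFrame v
  have h0 : (fun p ↦ chartCoord x₀ p (S.J p (bumpFrame χ v p))) =ᶠ[𝓝 y]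
      fun p ↦ chartJ S x₀ p v := by
    filter_upwards [(isOpen_frameSet χ).mem_nhds hy] with p hp
    rw [bumpFrame_apply hp]
    rfl
  have h1 := congrArg (chartCoord x₀ y) (h.parallel y _ hV (chartFrame x₀ y u))
  rw [chartCoord_nabla nabla hy (S.smoothAt_J hV).mdifferentiableAt, mvfderiv,
    h0.mfderiv_eq, chartCoord_chartFrame hy.1, bumpFrame_apply hy] at h1
  have h2 := mvfderiv_eq_fderiv_chartFun hy.1
    ((contMDiffAt_chartJ S hy v).mdifferentiableAt (by simp)) (chartFrame x₀ y u)
  rw [chartCoord_chartFrame hy.1] at h2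
  rw [fderiv_apply_const (contDiffOn_chartJ S) (isOpen_frameTarget χ)
    (chart_mem_frameTarget hy), eq_sub_iff_add_eq]
  refine (congrArg (· + _) h2.symm).trans (h1.trans ?_)
  change _ = chartCoord x₀ y (S.J y (chartFrame x₀ y _))
  rw [christoffel_eq_nabla nabla hy, chartFrame_chartCoord hy.1]

omit [RiemannianBundle fun x : M ↦ TangentSpace 𝓘(ℝ, E) x] in
theorem chartFrame_christoffel (hy : y ∈ frameSet χ) (u v : E) :
    chartFrame x₀ y (christoffel nabla χ y u v) = nabla (bumpFrame χ v) y (chartFrame x₀ y u) := by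
  rw [christoffel_eq_nabla nabla hy, chartFrame_chartCoord hy.1]

theorem IsMetric.fderiv_chartMetric
    [IsContMDiffRiemannianBundle 𝓘(ℝ, E) ∞ E (fun x : M ↦ TangentSpace 𝓘(ℝ, E) x)]
    (h : IsMetric nabla) (hy : y ∈ frameSet χ) (w u v : E) :
    fderiv ℝ (chartFun x₀ (chartMetric (E := E) (M := M) x₀)) (extChartAt 𝓘(ℝ, E) x₀ y) w u v
      = chartMetric x₀ y (christoffel nabla χ y w u) v
        + chartMetric x₀ y u (christoffel nabla χ y w v) := by
  have h0 : (fun p ↦ inner ℝ (bumpFrame χ u p) (bumpFrame χ v p)) =ᶠ[𝓝 y]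
      fun p ↦ chartMetric x₀ p u v := by
    filter_upwards [(isOpen_frameSet χ).mem_nhds hy] with p hp
    rw [bumpFrame_apply hp, bumpFrame_apply hp]
    rfl
  have h1 := h y _ _ (smoothAt_bumpFrame (χ := χ) u) (smoothAt_bumpFrame (χ := χ) v)
    (chartFrame x₀ y w)
  rw [mvfderiv, h0.mfderiv_eq, ← chartFrame_christoffel hy, ← chartFrame_christoffel hy,
    bumpFrame_apply hy, bumpFrame_apply hy] at h1
  have h2 := mvfderiv_eq_fderiv_chartFun hy.1
    ((contMDiffAt_chartMetric hy u v).mdifferentiableAt (by simp)) (chartFrame x₀ y w)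
  rw [chartCoord_chartFrame hy.1] at h2
  rw [fderiv_apply_const contDiffOn_chartMetric (isOpen_frameTarget χ)
    (chart_mem_frameTarget hy), fderiv_apply_const
    (A := fun z ↦ chartFun x₀ (chartMetric (E := E) (M := M) x₀) z u)
    (contDiffOn_chartMetric.clm_apply contDiffOn_const) (isOpen_frameTarget χ)
    (chart_mem_frameTarget hy)]
  exact h2.symm.trans h1

/-- The real Chern connection in a chart. -/
def IsRealChern.localChern
    [IsContMDiffRiemannianBundle 𝓘(ℝ, E) ∞ E (fun x : M ↦ TangentSpace 𝓘(ℝ, E) x)]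
    (h : IsRealChern S nabla) (χ : SmoothBumpFunction 𝓘(ℝ, E) x₀) :
    LocalChern E (frameTarget χ) where
  Γ := chartFun x₀ (christoffel nabla χ)
  J := chartFun x₀ (chartJ S x₀)
  g := chartFun x₀ (chartMetric x₀)
  isOpen := isOpen_frameTarget χ
  smooth_Γ := contDiffOn_christoffel h.smooth
  smooth_J := contDiffOn_chartJ S
  smooth_g := contDiffOn_chartMetric
  sq := fun z hz v ↦ by
    change chartCoord x₀ _ (S.J _ (chartFrame x₀ _ (chartCoord x₀ _ (S.J _ (chartFrame x₀ _ v)))))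
      = -v
    rw [chartFrame_chartCoord hz.2.1, S.sq, map_neg, chartCoord_chartFrame hz.2.1]
  symm := fun z hz u v ↦ real_inner_comm (chartFrame x₀ _ v) (chartFrame x₀ _ u)
  pos := fun z hz v hv ↦ by
    refine real_inner_self_pos (x := chartFrame x₀ _ v).2 fun h0 ↦ hv ?_
    have := congrArg (chartCoord x₀ _) h0
    rwa [chartCoord_chartFrame hz.2.1, map_zero] at this
  compat := fun z hz u v ↦ by
    change inner ℝ (chartFrame x₀ _ (chartCoord x₀ _ (S.J _ (chartFrame x₀ _ u))))
      (chartFrame x₀ _ (chartCoord x₀ _ (S.J _ (chartFrame x₀ _ v)))) = _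
    rw [chartFrame_chartCoord hz.2.1, chartFrame_chartCoord hz.2.1, S.compat]
    rfl
  parallel := frameTarget_cases fun y hy u v ↦ by
    rw [h.fderiv_chartJ S hy, chartFun_apply_chart hy.1, chartFun_apply_chart hy.1]
  metric := frameTarget_cases fun y hy w u v ↦ by
    rw [h.metric.fderiv_chartMetric hy, chartFun_apply_chart hy.1, chartFun_apply_chart hy.1]
  torsion_J' := fun z hz u v ↦ by
    have := FiniteDimensional.complete ℝ E
    have h1 := torsion_bumpFrame nabla hz.2 (chartFun x₀ (chartJ S x₀) z u) v
    have h2 := torsion_bumpFrame nabla hz.2 u v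
    refine h1.symm.trans ?_
    change _ = chartCoord x₀ _ (S.J _ (chartFrame x₀ _ (_ - _)))
    rw [chartFun, chartFun, ← h2, chartFrame_chartCoord hz.2.1, ← h.torsion_J]
    change chartCoord x₀ _ (nabla.torsion _ (chartFrame x₀ _ (chartCoord x₀ _
      (S.J _ (chartFrame x₀ _ u)))) _) = _
    rw [chartFrame_chartCoord hz.2.1]

end LocalChern

end Hermitian

/-! ### Curvature in coordinates -/

section Curvature

variable {E : Type*} [NormedAddCommGroup E] [NormedSpace ℝ E] [FiniteDimensional ℝ E]
  {M : Type*} [TopologicalSpace M] [T2Space M] [ChartedSpace E M] [IsManifold 𝓘(ℝ, E) ∞ M]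
  {nabla : CovariantDerivative 𝓘(ℝ, E) E (TangentSpace 𝓘(ℝ, E) : M → Type _)}
  {x₀ y : M} {χ : SmoothBumpFunction 𝓘(ℝ, E) x₀}
  {X Y Z : Π y : M, TangentSpace 𝓘(ℝ, E) y}

/-- The components of a vector field in the chart centered at `x₀`. -/
def chartField (x₀ : M) (X : Π y : M, TangentSpace 𝓘(ℝ, E) y) : E → E :=
  chartFun x₀ fun p ↦ chartCoord x₀ p (X p)

omit [FiniteDimensional ℝ E] [T2Space M] in
theorem contDiffAt_chartField (hy : y ∈ (chartAt E x₀).source) (hX : SmoothAt X y) :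
    ContDiffAt ℝ ∞ (chartField x₀ X) (extChartAt 𝓘(ℝ, E) x₀ y) :=
  contDiffAt_chartFun hy ((smoothAt_iff_chartCoord hy).1 hX)

omit [FiniteDimensional ℝ E] [T2Space M] in
theorem chartField_chart (hy : y ∈ (chartAt E x₀).source) :
    chartField x₀ X (extChartAt 𝓘(ℝ, E) x₀ y) = chartCoord x₀ y (X y) :=
  chartFun_apply_chart hy

omit [FiniteDimensional ℝ E] [T2Space M] in
theorem mvfderiv_chartCoord (hy : y ∈ (chartAt E x₀).source)
    (hX : MDifferentiableAt 𝓘(ℝ, E) (𝓘(ℝ, E).prod 𝓘(ℝ, E)) (fun p ↦ TotalSpace.mk' E p (X p)) y)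
    (w : TangentSpace 𝓘(ℝ, E) y) :
    mvfderiv 𝓘(ℝ, E) (fun p ↦ chartCoord x₀ p (X p)) y w
      = fderiv ℝ (chartField x₀ X) (extChartAt 𝓘(ℝ, E) x₀ y) (chartCoord x₀ y w) :=
  mvfderiv_eq_fderiv_chartFun hy ((mdifferentiableAt_iff_chartCoord hy).1 hX) w

omit [FiniteDimensional ℝ E] [T2Space M] in
theorem eventually_mdifferentiableAt (hX : SmoothAt X y) : ∀ᶠ p in 𝓝 y,
    MDifferentiableAt 𝓘(ℝ, E) (𝓘(ℝ, E).prod 𝓘(ℝ, E)) (fun p ↦ TotalSpace.mk' E p (X p)) p := by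
  have h1 : ContMDiffAt 𝓘(ℝ, E) (𝓘(ℝ, E).prod 𝓘(ℝ, E)) 1
      (fun p ↦ TotalSpace.mk' E p (X p)) y := ContMDiffAt.of_le hX (by simp)
  have : IsManifold 𝓘(ℝ, E) (1 + 1) M := .of_le (n := ∞) (by
    norm_num
    exact WithTop.coe_le_coe.2 le_top)
  filter_upwards [(contMDiffAt_iff_contMDiffAt_nhds (by simp)).1 h1] with p hp
  exact hp.mdifferentiableAt (by simp)

theorem eventuallyEq_chartField_nabla (hy : y ∈ frameSet χ) (hZ : SmoothAt Z y) :
    (fun p ↦ chartCoord x₀ p (nabla Z p (Y p))) =ᶠ[𝓝 y]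
      fun p ↦ fderiv ℝ (chartField x₀ Z) (extChartAt 𝓘(ℝ, E) x₀ p)
          (chartField x₀ Y (extChartAt 𝓘(ℝ, E) x₀ p))
        + chartFun x₀ (christoffel nabla χ) (extChartAt 𝓘(ℝ, E) x₀ p)
          (chartField x₀ Y (extChartAt 𝓘(ℝ, E) x₀ p))
          (chartField x₀ Z (extChartAt 𝓘(ℝ, E) x₀ p)) := by
  filter_upwards [(isOpen_frameSet χ).mem_nhds hy, eventually_mdifferentiableAt hZ] with p hp hZp
  rw [chartCoord_nabla nabla hp hZp, mvfderiv_chartCoord hp.1 hZp, chartField_chart hp.1,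
    chartField_chart hp.1, chartFun_apply_chart hp.1]

/-- Second covariant derivatives in coordinates. -/
theorem chartCoord_nabla_nabla
    (h : CovariantDerivative.ContMDiffCovariantDerivative nabla ∞) (hy : y ∈ frameSet χ)
    (hY : SmoothAt Y y) (hZ : SmoothAt Z y) {z : E} {G : E → E →L[ℝ] E →L[ℝ] E}
    {x' y' z' : E → E} (hz : z = extChartAt 𝓘(ℝ, E) x₀ y)
    (hG : G = chartFun x₀ (christoffel nabla χ)) (hx' : x' = chartField x₀ X)
    (hy' : y' = chartField x₀ Y) (hz' : z' = chartField x₀ Z) :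
    chartCoord x₀ y (nabla (fun p ↦ nabla Z p (Y p)) y (X y))
      = fderiv ℝ (fderiv ℝ z') z (x' z) (y' z) + fderiv ℝ z' z (fderiv ℝ y' z (x' z))
        + fderiv ℝ G z (x' z) (y' z) (z' z) + G z (fderiv ℝ y' z (x' z)) (z' z)
        + G z (y' z) (fderiv ℝ z' z (x' z))
        + G z (x' z) (fderiv ℝ z' z (y' z) + G z (y' z) (z' z)) := by
  have cy : ContDiffAt ℝ ∞ y' z := by subst hy' hz; exact contDiffAt_chartField hy.1 hY
  have cz : ContDiffAt ℝ ∞ z' z := by subst hz' hz; exact contDiffAt_chartField hy.1 hZ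
  have cG : ContDiffAt ℝ ∞ G z := by
    subst hG hz
    exact (contDiffOn_christoffel h).contDiffAt
      ((isOpen_frameTarget χ).mem_nhds (chart_mem_frameTarget hy))
  have cz2 : ContDiffAt ℝ ∞ (fderiv ℝ z') z := cz.fderiv_right (by simp)
  have c1 : ContDiffAt ℝ ∞ (fun q ↦ fderiv ℝ z' q (y' q) + G q (y' q) (z' q)) z :=
    (cz2.clm_apply cy).add ((cG.clm_apply cy).clm_apply cz)
  have e0 := eventuallyEq_chartField_nabla (nabla := nabla) (Y := Y) hy hZ
  rw [← hG, ← hy', ← hz'] at e0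
  have d0 : MDifferentiableAt 𝓘(ℝ, E) 𝓘(ℝ, E)
      (fun p ↦ chartCoord x₀ p (nabla Z p (Y p))) y := by
    refine MDifferentiableAt.congr_of_eventuallyEq ?_ e0
    rw [hz] at c1
    exact (c1.differentiableAt (by simp)).mdifferentiableAt.comp y
      ((contMDiffAt_chart hy.1).mdifferentiableAt (by simp))
  have d1 := (mdifferentiableAt_iff_chartCoord hy.1).2 d0
  have e1 : chartField x₀ (fun p ↦ nabla Z p (Y p)) =ᶠ[𝓝 z]
      fun q ↦ fderiv ℝ z' q (y' q) + G q (y' q) (z' q) := by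
    have t := (contMDiffAt_chart_symm (x₀ := x₀) hy.1).continuousAt.tendsto
    rw [(extChartAt 𝓘(ℝ, E) x₀).left_inv (by rw [extChartAt_source]; exact hy.1), ← hz] at t
    have hm := (isOpen_frameTarget χ).mem_nhds (chart_mem_frameTarget hy)
    rw [← hz] at hm
    filter_upwards [t.eventually e0, hm] with q hq hq'
    rw [(extChartAt 𝓘(ℝ, E) x₀).right_inv hq'.1] at hq
    exact hq
  have l1 := ((hasLineDerivAt_fderiv (cz2.differentiableAt (by simp)) (x' z)).clm_apply
    (hasLineDerivAt_fderiv (cy.differentiableAt (by simp)) (x' z))).add'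
    (((hasLineDerivAt_fderiv (cG.differentiableAt (by simp)) (x' z)).clm_apply
    (hasLineDerivAt_fderiv (cy.differentiableAt (by simp)) (x' z))).clm_apply
    (hasLineDerivAt_fderiv (cz.differentiableAt (by simp)) (x' z)))
  have l2 := (hasLineDerivAt_fderiv (c1.differentiableAt (by simp)) (x' z)).unique l1
  have xy : chartCoord x₀ y (X y) = x' z := by rw [hx', hz, chartField_chart hy.1]
  have yy : chartCoord x₀ y (Y y) = y' z := by rw [hy', hz, chartField_chart hy.1]
  have zy : chartCoord x₀ y (Z y) = z' z := by rw [hz', hz, chartField_chart hy.1]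
  have Gy : christoffel nabla χ y = G z := by rw [hG, hz, chartFun_apply_chart hy.1]
  rw [chartCoord_nabla nabla hy d1, mvfderiv_chartCoord hy.1 d1,
    chartCoord_nabla nabla hy hZ.mdifferentiableAt, mvfderiv_chartCoord hy.1 hZ.mdifferentiableAt,
    ← hz, ← hz', e1.fderiv_eq, xy, l2, yy, zy, Gy]
  simp only [add_apply, map_add]
  module

/-- First derivatives of the fields cancel, partly against `∇_{[X, Y]} Z`, and second derivatives of
`Z` cancel by symmetry. Only values at `y` remain, so the extensions chosen in `curvature` do not
matter. -/
theorem chartCoord_curvatureField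
    (h : CovariantDerivative.ContMDiffCovariantDerivative nabla ∞) (hy : y ∈ frameSet χ)
    (hX : SmoothAt X y) (hY : SmoothAt Y y) (hZ : SmoothAt Z y) {z : E} {G : E → E →L[ℝ] E →L[ℝ] E}
    (hz : z = extChartAt 𝓘(ℝ, E) x₀ y) (hG : G = chartFun x₀ (christoffel nabla χ)) {u v w : E}
    (hu : u = chartCoord x₀ y (X y)) (hv : v = chartCoord x₀ y (Y y))
    (hw : w = chartCoord x₀ y (Z y)) :
    chartCoord x₀ y (curvatureField nabla X Y Z y)
      = fderiv ℝ G z u v w - fderiv ℝ G z v u w + G z u (G z v w) - G z v (G z u w) := by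
  have h1 := chartCoord_nabla_nabla (X := X) h hy hY hZ hz hG rfl rfl rfl
  have h2 := chartCoord_nabla_nabla (X := Y) h hy hX hZ hz hG rfl rfl rfl
  have h3 := chartCoord_nabla nabla hy hZ.mdifferentiableAt (mlieBracket 𝓘(ℝ, E) X Y y)
  rw [mvfderiv_chartCoord hy.1 hZ.mdifferentiableAt, chartCoord_mlieBracket nabla hy hX hY,
    mvfderiv_chartCoord hy.1 hX.mdifferentiableAt, mvfderiv_chartCoord hy.1 hY.mdifferentiableAt]
    at h3
  have Gy : christoffel nabla χ y = G z := by rw [hG, hz, chartFun_apply_chart hy.1]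
  have cz : ContDiffAt ℝ ∞ (chartField x₀ Z) z := by
    subst hz; exact contDiffAt_chartField hy.1 hZ
  have sym := (cz.isSymmSndFDerivAt
    (by rw [minSmoothness_of_isRCLikeNormedField]; exact WithTop.coe_le_coe.2 le_top)) u v
  have xy : chartField x₀ X z = u := by rw [hu, hz, chartField_chart hy.1]
  have yy : chartField x₀ Y z = v := by rw [hv, hz, chartField_chart hy.1]
  have zy : chartField x₀ Z z = w := by rw [hw, hz, chartField_chart hy.1]
  rw [curvatureField, map_sub, map_sub, h1, h2, h3, ← hz, ← hu, ← hv, ← hw, xy, yy, zy, Gy, sym]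
  simp only [map_add, map_sub, sub_apply]
  module

theorem chartCoord_curvature
    (h : CovariantDerivative.ContMDiffCovariantDerivative nabla ∞) (hy : y ∈ frameSet χ)
    {z : E} {G : E → E →L[ℝ] E →L[ℝ] E}
    (hz : z = extChartAt 𝓘(ℝ, E) x₀ y) (hG : G = chartFun x₀ (christoffel nabla χ)) (u v w : E) :
    chartCoord x₀ y (curvature nabla y (chartFrame x₀ y u) (chartFrame x₀ y v) (chartFrame x₀ y w))
      = fderiv ℝ G z u v w - fderiv ℝ G z v u w + G z u (G z v w) - G z v (G z u w) := by
  refine chartCoord_curvatureField h hy (smoothAt_extend y _) (smoothAt_extend y _)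
    (smoothAt_extend y _) hz hG ?_ ?_ ?_ <;>
  rw [FiberBundle.extend_apply_self, chartCoord_chartFrame hy.1]

end Curvature

/-! ### Vanishing of the torsion and the Kähler property -/

section Main

variable {E : Type*} [NormedAddCommGroup E] [NormedSpace ℝ E] [FiniteDimensional ℝ E]
  {M : Type*} [TopologicalSpace M] [T2Space M] [ChartedSpace E M] [IsManifold 𝓘(ℝ, E) ∞ M]
  [RiemannianBundle (fun x : M ↦ TangentSpace 𝓘(ℝ, E) x)]
  {S : HermitianStructure E M}
  {nabla : CovariantDerivative 𝓘(ℝ, E) E (TangentSpace 𝓘(ℝ, E) : M → Type _)}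
  {x₀ y : M} {χ : SmoothBumpFunction 𝓘(ℝ, E) x₀}

section

variable [IsContMDiffRiemannianBundle 𝓘(ℝ, E) ∞ E (fun x : M ↦ TangentSpace 𝓘(ℝ, E) x)]

theorem IsRealChern.localChern_g (h : IsRealChern S nabla) (hy : y ∈ frameSet χ) (u v : E) :
    (h.localChern S χ).g (extChartAt 𝓘(ℝ, E) x₀ y) u v
      = inner ℝ (chartFrame x₀ y u) (chartFrame x₀ y v) :=
  congrArg (fun L : E →L[ℝ] E →L[ℝ] ℝ ↦ L u v)
    (chartFun_apply_chart (f := chartMetric (E := E) (M := M) x₀) hy.1)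

theorem IsRealChern.localChern_Γ (h : IsRealChern S nabla) (hy : y ∈ frameSet χ) :
    (h.localChern S χ).Γ (extChartAt 𝓘(ℝ, E) x₀ y) = christoffel nabla χ y :=
  chartFun_apply_chart (f := christoffel nabla χ) hy.1

theorem IsRealChern.curvature_eq (h : IsRealChern S nabla) (hy : y ∈ frameSet χ) (u v w : E) :
    curvature nabla y (chartFrame x₀ y u) (chartFrame x₀ y v) (chartFrame x₀ y w)
      = chartFrame x₀ y ((h.localChern S χ).R (extChartAt 𝓘(ℝ, E) x₀ y) u v w) := by
  rw [LocalChern.R_apply]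
  refine Eq.trans ?_ (congrArg (chartFrame x₀ y)
    (chartCoord_curvature h.smooth hy rfl rfl u v w))
  rw [chartFrame_chartCoord hy.1]

theorem IsRealChern.ricci_eq (h : IsRealChern S nabla) (hy : y ∈ frameSet χ) (u v : E) :
    ricci nabla y (chartFrame x₀ y u) (chartFrame x₀ y v)
      = -traceCLM E (((h.localChern S χ).R (extChartAt 𝓘(ℝ, E) x₀ y) u).flip v) := by
  set D := h.localChern S χ
  set z := extChartAt 𝓘(ℝ, E) x₀ y
  -- The coordinate frame transports the trace to the tangent space, where it can be computed in the
  -- orthonormal basis.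
  let e : E ≃ₗ[ℝ] TangentSpace 𝓘(ℝ, E) y :=
    LinearEquiv.ofLinearMap (chartFrame x₀ y).toLinearMap (chartCoord x₀ y).toLinearMap
      (LinearMap.ext (chartFrame_chartCoord hy.1)) (LinearMap.ext (chartCoord_chartFrame hy.1))
  set b := stdOrthonormalBasis ℝ (TangentSpace 𝓘(ℝ, E) y)
  have h1 : traceCLM E ((D.R z u).flip v)
      = LinearMap.trace ℝ (TangentSpace 𝓘(ℝ, E) y) (e.conj ((D.R z u).flip v : E →ₗ[ℝ] E)) := by
    rw [LinearMap.trace_conj', traceCLM_apply]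
  rw [h1, LinearMap.trace_eq_sum_inner _ b, ricci, ← Finset.sum_neg_distrib]
  refine Finset.sum_congr rfl fun i _ ↦ ?_
  -- Skewness moves the curvature from `eᵢ` to `v`; this is the source of the minus sign.
  have h2 := D.R_skew (chart_mem_frameTarget hy) u (chartCoord x₀ y (b i)) (chartCoord x₀ y (b i)) v
  have h3 := h.curvature_eq hy u (chartCoord x₀ y (b i)) (chartCoord x₀ y (b i))
  rw [chartFrame_chartCoord hy.1] at h3
  rw [h.localChern_g hy, h.localChern_g hy, chartFrame_chartCoord hy.1, ← h3] at h2
  exact h2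

/-- A real Chern connection that is Einstein with nonzero constant is torsion free. -/
theorem IsRealChern.torsion_eq_zero (h : IsRealChern S nabla) {c : ℝ} (hc : c ≠ 0)
    (hE : IsEinsteinWith nabla c) (x : M) (u v : TangentSpace 𝓘(ℝ, E) x) :
    haveI := FiniteDimensional.complete ℝ E
    nabla.torsion x u v = 0 := by
  have := FiniteDimensional.complete ℝ E
  obtain ⟨χ⟩ : Nonempty (SmoothBumpFunction 𝓘(ℝ, E) x) := inferInstance
  have hx := center_mem_frameSet χ
  have hE' : ∀ z ∈ frameTarget χ, ∀ u v, traceCLM E (((h.localChern S χ).R z u).flip v)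
      = -(c * (h.localChern S χ).g z u v) := frameTarget_cases fun y hy u v ↦ by
    rw [← neg_eq_iff_eq_neg, ← h.ricci_eq hy, hE, h.localChern_g hy]
  have h1 := (h.localChern S χ).T_eq_zero hc hE' (chart_mem_frameTarget hx)
    (chartCoord x x u) (chartCoord x x v)
  have h2 := torsion_bumpFrame nabla hx (chartCoord x x u) (chartCoord x x v)
  rw [chartFrame_chartCoord hx.1, chartFrame_chartCoord hx.1] at h2
  rw [← chartFrame_chartCoord hx.1 (nabla.torsion x u v), h2]
  rw [LocalChern.T_apply, h.localChern_Γ hx] at h1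
  rw [h1, map_zero]

theorem IsRealChern.isLeviCivita (h : IsRealChern S nabla) {c : ℝ} (hc : c ≠ 0)
    (hE : IsEinsteinWith nabla c) : IsLeviCivita nabla where
  smooth := h.smooth
  metric := h.metric
  torsion_free := fun x X Y hX hY ↦ by
    have := FiniteDimensional.complete ℝ E
    have h1 := nabla.torsion_apply hX.mdifferentiableAt hY.mdifferentiableAt
    rw [h.torsion_eq_zero hc hE] at h1
    exact (sub_eq_zero.1 h1.symm)

end

omit [FiniteDimensional ℝ E] [T2Space M] in
theorem HermitianStructure.inner_J (S : HermitianStructure E M) (x : M)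
    (u v : TangentSpace 𝓘(ℝ, E) x) : inner ℝ (S.J x u) v = -inner ℝ u (S.J x v) := by
  rw [← S.compat, S.sq, inner_neg_left]

-- Metricity and `∇J = 0` expand the derivatives of `ω`, torsion-freeness expands the brackets, and
-- everything cancels because `J` is skew.
omit [FiniteDimensional ℝ E] [T2Space M] in
theorem isKahler_of_isLeviCivita (h : IsLeviCivita nabla)
    (hJ : ∀ (x : M) (Y : Π y : M, TangentSpace 𝓘(ℝ, E) y), SmoothAt Y x →
      ∀ u : TangentSpace 𝓘(ℝ, E) x, nabla (fun y ↦ S.J y (Y y)) x u = S.J x (nabla Y x u)) :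
    IsKahler S := by
  intro x X Y Z hX hY hZ
  have key : ∀ A B : Π y : M, TangentSpace 𝓘(ℝ, E) y, SmoothAt A x → SmoothAt B x → ∀ u,
      mvfderiv 𝓘(ℝ, E) (fundamentalForm S A B) x u
        = inner ℝ (S.J x (nabla A x u)) (B x) + inner ℝ (S.J x (A x)) (nabla B x u) :=
    fun A B hA hB u ↦ by
      rw [← hJ x A hA]
      exact h.metric x _ _ (S.smoothAt_J hA) hB u
  have sw : ∀ u v : TangentSpace 𝓘(ℝ, E) x, inner ℝ (S.J x u) v = -inner ℝ (S.J x v) u :=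
    fun u v ↦ by rw [S.inner_J, real_inner_comm]
  rw [key Y Z hY hZ, key X Z hX hZ, key X Y hX hY]
  simp only [fundamentalForm, ← h.torsion_free x X Y hX hY, ← h.torsion_free x X Z hX hZ,
    ← h.torsion_free x Y Z hY hZ, map_sub, inner_sub_left]
  rw [sw (Y x), sw (X x), sw (X x)]
  ring

end Main

end HermGeom
end

theorem theorem1p2 {E : Type*} [NormedAddCommGroup E] [NormedSpace ℝ E] [FiniteDimensional ℝ E]
    {M : Type*} [TopologicalSpace M] [T2Space M] [CompactSpace M] [ChartedSpace E M]
    [IsManifold 𝓘(ℝ, E) ∞ M]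
    [RiemannianBundle (fun x : M ↦ TangentSpace 𝓘(ℝ, E) x)]
    [IsContMDiffRiemannianBundle 𝓘(ℝ, E) ∞ E (fun x : M ↦ TangentSpace 𝓘(ℝ, E) x)]
    (S : HermGeom.HermitianStructure E M) (c : ℝ) (hc : c ≠ 0)
    (hS : HermGeom.IsRealChernEinstein S c) :
    HermGeom.IsKahlerEinstein S := by
  obtain ⟨nabla, h, hE⟩ := hS
  have hLC := h.isLeviCivita hc hE
  -- The Levi-Civita connection is the Chern connection itself, so the Einstein constant is the same
  -- `c`.
  exact ⟨HermGeom.isKahler_of_isLeviCivita hLC h.parallel, nabla, hLC, c, hE⟩
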